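/- **Notation.** For $b_1,b_2>0$ partition $\mathbb R^3$ into the grid of cubes $C_n$ of side length $b_1/\sqrt3$ and let $n(b_1,b_2)=\max_{x\in\mathbb R^3}\#\{n: C_n\cap B_{b_2}(x)\ne\emptyset\}$, where $B_r(x)$ is the open ball. For $V:\mathbb R^3\to\mathbb R$ let $V^\pm\ge 0$ be its positive and negative part, $V=V^+-V^-$, and for $N\in\mathbb N$ put $V_1(x)=N^2V(Nx)$ and $V_1^\pm(x)=N^2V^\pm(Nx)$. For $1\le j\le N$ let $$\overline{\mathcal B}_j=\{(x_1,\dots,x_N)\in\mathbb R^{3N}:\ |x_k-x_l|<N^{-26/27}\text{ for some } k\ne l \text{ with } k,l\neq j\}.$$ **Assumption 1.** $V\in L^\infty(\mathbb R^3,\mathbb R)$ is spherically symmetric, and there are $R>r_2>0$, $r_1>0$, $\lambda^+>0$ such that 1. $\operatorname{supp}V^+=\overline{B_{r_2}(0)}$ and $\operatorname{supp}V^-=\overline{B_R(0)}\setminus B_{r_2}(0)$ (closed supports); 2. $V^+(x)\ge\lambda^+$ for all $x\in B_{r_1}(0)$; 3. with $n_1=n(r_1,R)$, $n_2=n(r_1,3R)$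 and $\lambda^-=\|V^-\|_\infty$, we have $\lambda^+>8n_2\lambda^-$, and for some $0<\epsilon_0<1$ $$\int_{B_R(0)}\Big(|\nabla\phi(x)|^2+\frac{n_1}{1-\epsilon_0}\big(2V^+(x)-4V^-(x)\big)|\phi(x)|^2\Big)\,d^3x\ \ge 0$$ for all $\phi\in C^1(\mathbb R^3,\mathbb C)$ with $\phi(x)=1$ whenever $|x|=R$. Operator inequalities on $L^2(\mathbb R^{3N},\mathbb C)$ are understood in the sense of quadratic forms on $H^1(\mathbb R^{3N},\mathbb C)$; thus $-\Delta_k$ stands for $\|\nabla_k\Psi\|^2$ and $-\Delta_k\mathbf 1_{\overline{\mathcal B}_k}$ for $\|\mathbf 1_{\overline{\mathcal B}_k}\nabla_k\Psi\|^2$. **Theorem.** Let $V$ satisfy Assumption 1. Then: (a) For every $N$, $$-\sum_{k=1}^N\Delta_k+\sum_{1\le i<j\le N}V(x_i-x_j)\ \ge 0 .$$ (b) There is $\epsilon\in(0,1)$, independent of $N$, such that for every $N$ $$-\sum_{k=1}^N\Delta_k+\sum_{1\le i<j\le N}\big(V_1^+(x_i-x_j)-(1+\epsilon)V_1^-(x_i-x_j)\big)\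 \ge 0$$ and $$(1-\epsilon)\sum_{k=1}^N-\Delta_k\mathbf 1_{\overline{\mathcal B}_k}+\sum_{i\ne j}\mathbf 1_{\overline{\mathcal B}_j}\,\tfrac12V_1(x_i-x_j)\ \ge 0 .$$ -/

import Mathlib

open MeasureTheory
open scoped ENNReal ContDiff

noncomputable section

/-- Euclidean three-space, the configuration space of one particle. -/
abbrev R3 : Type := EuclideanSpace ℝ (Fin 3)

/-- Configurations `(x_1, …, x_N)` of `N` particles; its volume is the Lebesgue measure of
`ℝ^{3N}`. -/
abbrev Config (N : ℕ) : Type := Fin N → R3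

/-! ### Cubes -/

/-- The cube with index `m ∈ ℤ³` in the partition of `ℝ³` into half-open cubes of side `s`. -/
def gridCube (s : ℝ) (m : Fin 3 → ℤ) : Set R3 :=
  {y | ∀ a, (m a : ℝ) * s ≤ y a ∧ y a < ((m a : ℝ) + 1) * s}

/-- The indices of the cubes of side `b₁ / √3` that meet the open ball of radius `b₂` about `x`. -/
def cubesMeeting (b₁ b₂ : ℝ) (x : R3) : Set (Fin 3 → ℤ) :=
  {m | (gridCube (b₁ / √3) m ∩ Metric.ball x b₂).Nonempty}

/-- `n(b₁, b₂)`: the maximal number of cubes of side `b₁ / √3` that meet a ball of radius `b₂`. -/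
def cubeCount (b₁ b₂ : ℝ) : ℕ := ⨆ x : R3, (cubesMeeting b₁ b₂ x).ncard

/-- The numbers of which `cubeCount` is the supremum count finite sets. -/
theorem cubesMeeting_subset (b₁ b₂ : ℝ) (h₁ : 0 < b₁) (x : R3) :
    cubesMeeting b₁ b₂ x ⊆ (Fintype.piFinset fun a : Fin 3 =>
      Finset.Icc (⌊(x a - b₂) / (b₁ / √3)⌋) (⌊(x a - b₂) / (b₁ / √3)⌋
        + ⌈2 * b₂ / (b₁ / √3)⌉ + 1) : Finset (Fin 3 → ℤ)) := by
  intro m hm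
  obtain ⟨y, hy, hyx⟩ := hm
  have hs : 0 < b₁ / √3 := by positivity
  rw [Finset.mem_coe, Fintype.mem_piFinset]
  intro a
  have hd : |y a - x a| < b₂ := by
    have h := PiLp.norm_apply_le (y - x) a
    rw [Metric.mem_ball, dist_eq_norm] at hyx
    have h' : ‖(y - x) a‖ = |y a - x a| := by simp [Real.norm_eq_abs]
    linarith
  obtain ⟨hd1, hd2⟩ := abs_lt.1 hd
  obtain ⟨h1, h2⟩ := hy a
  have e1 : (x a - b₂) / (b₁ / √3) < (m a : ℝ) + 1 := by
    rw [div_lt_iff₀ hs]; linarith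
  have e2 : (m a : ℝ) < (x a - b₂) / (b₁ / √3) + 2 * b₂ / (b₁ / √3) := by
    rw [← add_div, lt_div_iff₀ hs]; linarith
  have f1 := Int.floor_le ((x a - b₂) / (b₁ / √3))
  have f2 := Int.lt_floor_add_one ((x a - b₂) / (b₁ / √3))
  have f3 := Int.le_ceil (2 * b₂ / (b₁ / √3))
  rw [Finset.mem_Icc]
  constructor
  · have : ((⌊(x a - b₂) / (b₁ / √3)⌋ : ℤ) : ℝ) < (m a : ℝ) + 1 := lt_of_le_of_lt f1 e1
    have h3 : ⌊(x a - b₂) / (b₁ / √3)⌋ < m a + 1 := by exact_mod_cast this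
    omega
  · have : (m a : ℝ) < (⌊(x a - b₂) / (b₁ / √3)⌋ : ℝ) + (⌈2 * b₂ / (b₁ / √3)⌉ : ℝ) + 1 := by
      linarith
    exact_mod_cast this.le

/-- The supremum that defines `cubeCount` is that of a bounded set. -/
theorem bddAbove_ncard_cubesMeeting (b₁ b₂ : ℝ) (h₁ : 0 < b₁) :
    BddAbove (Set.range fun x : R3 => (cubesMeeting b₁ b₂ x).ncard) := by
  refine ⟨∏ _a : Fin 3, (⌈2 * b₂ / (b₁ / √3)⌉ + 2).toNat, ?_⟩
  rintro _ ⟨x, rfl⟩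
  have h := Set.ncard_le_ncard (cubesMeeting_subset b₁ b₂ h₁ x) (Finset.finite_toSet _)
  rw [Set.ncard_coe_finset, Fintype.card_piFinset] at h
  refine h.trans (le_of_eq (Finset.prod_congr rfl fun a _ => ?_))
  rw [Int.card_Icc]
  congr 1
  ring

/-! ### The class of interaction potentials -/

/-- `|∇φ(x)|²` for a differentiable function `φ` on `ℝ³`. -/
def gradSq (φ : R3 → ℂ) (x : R3) : ℝ :=
  ∑ a : Fin 3, ‖fderiv ℝ φ x (EuclideanSpace.single a 1)‖ ^ 2

/-- The energy functional
`∫_{B_R(0)} (|∇φ|² + (1 - ε)⁻¹ n(r₁, R) (2 V⁺ - 4 V⁻) |φ|²)`. -/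
def ballEnergy (V : R3 → ℝ) (r₁ R ε : ℝ) (φ : R3 → ℂ) : ℝ :=
  ∫ x in Metric.ball (0 : R3) R,
    (gradSq φ x + 1 / (1 - ε) * (cubeCount r₁ R : ℝ) * (2 * (V x)⁺ - 4 * (V x)⁻) * ‖φ x‖ ^ 2)

/-- The standing assumption on the interaction `V = V⁺ - V⁻`. As `V⁺, V⁻ ≥ 0` have disjoint
supports, they are the positive and the negative part of `V`. -/
structure PotentialAssumption (V : R3 → ℝ) (r₁ r₂ R lam : ℝ) : Prop where
  memLp_top : MemLp V ∞ volume
  radial : ∀ x y : R3, ‖x‖ = ‖y‖ → V x = V y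
  r₂_pos : 0 < r₂
  r₂_lt : r₂ < R
  support_pos : tsupport (fun x => (V x)⁺) = Metric.closedBall 0 r₂
  support_neg : tsupport (fun x => (V x)⁻) = Metric.closedBall 0 R \ Metric.ball 0 r₂
  r₁_pos : 0 < r₁
  lam_pos : 0 < lam
  core : ∀ x ∈ Metric.ball (0 : R3) r₁, lam ≤ (V x)⁺
  energy_nonneg : ∃ ε : ℝ, 0 < ε ∧ ε < 1 ∧ ∀ φ : R3 → ℂ, ContDiff ℝ 1 φ →
    (∀ x : R3, ‖x‖ = R → φ x = 1) → 0 ≤ ballEnergy V r₁ R ε φ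
  core_gt : 8 * (cubeCount r₁ (3 * R) : ℝ) *
    (eLpNorm (fun x => (V x)⁻) ∞ volume).toReal < lam

/-! ### Wave functions and quadratic forms -/

/-- `g` is the weak derivative of `Ψ` in the direction of the `a`-th coordinate of the `k`-th
particle. -/
def HasWeakPartial {N : ℕ} (Ψ g : Config N → ℂ) (k : Fin N) (a : Fin 3) : Prop :=
  ∀ η : Config N → ℝ, ContDiff ℝ ∞ η → HasCompactSupport η →
    ∫ x, fderiv ℝ η x (Pi.single k (EuclideanSpace.single a 1)) • Ψ x = -∫ x, η x • g x

/-- `Ψ ∈ H¹(ℝ^{3N}, ℂ)` with weak gradient `D`: `D k a` is the derivative of `Ψ` in the `a`-th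
coordinate of the `k`-th particle. -/
structure IsH1 {N : ℕ} (Ψ : Config N → ℂ) (D : Fin N → Fin 3 → Config N → ℂ) : Prop where
  memLp : MemLp Ψ 2 volume
  memLp_grad : ∀ k a, MemLp (D k a) 2 volume
  weak : ∀ k a, HasWeakPartial Ψ (D k a) k a

/-- The localized kinetic energy `∑_k ‖𝟙_{S_k} ∇_k Ψ‖²`, where `D` is the gradient of `Ψ`. It is the
quadratic form of `-∑_k Δ_k 𝟙_{S_k}` if the condition `x ∈ S_k` does not involve `x_k`. -/
def kineticForm {N : ℕ} (S : Fin N → Set (Config N)) (D : Fin N → Fin 3 → Config N → ℂ) : ℝ :=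
  ∑ k, ∫ x in S k, ∑ a, ‖D k a x‖ ^ 2

/-- `⟨Ψ, ∑_{i<j} U(x_i - x_j) Ψ⟩`. -/
def pairForm {N : ℕ} (U : R3 → ℝ) (Ψ : Config N → ℂ) : ℝ :=
  ∑ i : Fin N, ∑ j ∈ Finset.Ioi i, ∫ x, U (x i - x j) * ‖Ψ x‖ ^ 2

/-- `⟨Ψ, ∑_{i≠j} 𝟙_{S_j} ½ U(x_i - x_j) Ψ⟩`. -/
def localizedPairForm {N : ℕ} (S : Fin N → Set (Config N)) (U : R3 → ℝ) (Ψ : Config N → ℂ) : ℝ :=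
  ∑ j : Fin N, ∑ i ∈ Finset.univ.erase j, ∫ x in S j, 1 / 2 * U (x i - x j) * ‖Ψ x‖ ^ 2

/-- The operator inequality `-∑_k Δ_k + ∑_{i<j} U(x_i - x_j) ≥ 0` on `L²(ℝ^{3N}, ℂ)`, in the sense
of quadratic forms on the form domain `H¹(ℝ^{3N}, ℂ)`. -/
def HamiltonianNonneg (N : ℕ) (U : R3 → ℝ) : Prop :=
  ∀ (Ψ : Config N → ℂ) (D : Fin N → Fin 3 → Config N → ℂ), IsH1 Ψ D →
    0 ≤ kineticForm (fun _ => Set.univ) D + pairForm U Ψ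

/-- The operator inequality
`c ∑_k -Δ_k 𝟙_{S_k} + ∑_{i≠j} 𝟙_{S_j} ½ U(x_i - x_j) ≥ 0` on `L²(ℝ^{3N}, ℂ)`, in the sense of
quadratic forms on `H¹(ℝ^{3N}, ℂ)`. -/
def LocalizedHamiltonianNonneg (N : ℕ) (S : Fin N → Set (Config N)) (c : ℝ) (U : R3 → ℝ) : Prop :=
  ∀ (Ψ : Config N → ℂ) (D : Fin N → Fin 3 → Config N → ℂ), IsH1 Ψ D →
    0 ≤ c * kineticForm S D + localizedPairForm S U Ψ

/-- The configurations in which two distinct particles `j, k`, both different from `l`, have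
distance less than `N^{-26/27}`. -/
def otherPairClose (N : ℕ) (l : Fin N) : Set (Config N) :=
  {x | ∃ j k : Fin N, j ≠ k ∧ j ≠ l ∧ k ≠ l ∧ ‖x j - x k‖ < (N : ℝ) ^ (-(26 / 27 : ℝ))}

/-- The scaled interaction `V_1(x) = N² V(N x)`. -/
def scaled (N : ℕ) (V : R3 → ℝ) (x : R3) : ℝ := (N : ℝ) ^ 2 * V ((N : ℝ) • x)

end

/-! All three inequalities are cases of one localized estimate, with the attraction enlarged to
`9/8` of itself and the kinetic energy cut to `7/8`. Here the sets `S j` do not depend on the `j`-th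
particle, and every configuration lies in no `S j` or in all but at most two of them. The whole
space gives the unlocalized inequalities, and `otherPairClose` gives the localized one: a close pair
excludes at most its own two members. Thus `ε = 1/8` serves for every `N`.

Space is cut into cubes of diameter `r₁`, so particles in a common cube repel with strength at least
`lam`. For each `j`, the other particles are called sparse or crowded according to whether their
cube holds at most four particles other than `j`.

Sparse particles are paid for by the kinetic energy of particle `j`. A ball of radius `R` meets at
most `n₁` cubes, so every point lies in the `R`-balls of at most `4 n₁` sparse particles. Adding the
ball inequality over these balls therefore uses each piece of gradient at most `4 n₁` times
(`one_particle_nonneg`, and after Fubini `kinetic_add_sparse_nonneg`). The ball inequality is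
assumed only for functions equal to `1` on the sphere. `energy_nonneg` extends it to all `C¹`
functions: dropping angular derivatives splits the energy into rays, and each ray is the profile of
a radial function, which is constant on the sphere.

Crowded particles are paid for by the repulsion inside their cubes. A cube with `m ≥ 5` particles
has about `m²` repelling pairs, while the attraction to crowded cubes is at most `n₂ Λ ∑ m²`. Since
`lam ≥ 8 n₂ Λ`, repulsion wins even if two particles are left out (`cluster_energy_nonneg`).

`localized_nonneg_of_contDiff` joins both halves for `C¹` functions; mollification
(`IsH1.exists_approx`) and `L²` continuity of the forms carry it over to `H¹`.
`exists_isCellPotential` corrects `V` on a null set so that its bounds hold everywhere, and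
`IsCellPotential.scale` shows that `n₁` and `n₂` survive scaling, which makes the result uniform in
`N`. -/

noncomputable section

/-! ### Mollification in `L²`. -/

section Mollification

open Filter Topology
open scoped Convolution

/-- The square of the `L²` seminorm is the integral of the square. -/
theorem eLpNorm_two_sq {α E : Type*} [MeasurableSpace α] [NormedAddCommGroup E] (f : α → E)
    (μ : Measure α) : eLpNorm f 2 μ ^ 2 = ∫⁻ x, ‖f x‖ₑ ^ 2 ∂μ := by
  have h := eLpNorm_nnreal_pow_eq_lintegral (f := f) (μ := μ) (p := 2) (by norm_num)
  simpa using h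

variable {G : Type*} [NormedAddCommGroup G] [NormedSpace ℝ G] [FiniteDimensional ℝ G]
  [MeasurableSpace G] [BorelSpace G] {μ : Measure G} [μ.IsAddHaarMeasure]

/-- Jensen's inequality for a mollification. -/
theorem enorm_normed_convolution_sq_le (φ : ContDiffBump (0 : G)) {f : G → ℂ}
    (hf : AEStronglyMeasurable f μ) (x : G) :
    ‖(φ.normed μ ⋆[ContinuousLinearMap.lsmul ℝ ℝ, μ] f) x‖ₑ ^ 2 ≤
      ∫⁻ y, ‖φ.normed μ y‖ₑ * ‖f (x - y)‖ₑ ^ 2 ∂μ := by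
  -- The bump is the density of a probability measure, for which the `L¹` norm is at most the `L²`
  -- norm.
  set d : G → ℝ≥0∞ := fun y => ‖φ.normed μ y‖ₑ with hd
  have hdm : Measurable d := φ.continuous_normed.measurable.enorm
  have hprob : IsProbabilityMeasure (μ.withDensity d) := by
    refine ⟨?_⟩
    rw [withDensity_apply _ MeasurableSet.univ, Measure.restrict_univ]
    have h1 : ∫⁻ y, d y ∂μ = ENNReal.ofReal (∫ y, φ.normed μ y ∂μ) := by
      rw [ofReal_integral_eq_lintegral_ofReal φ.integrable_normed
        (Eventually.of_forall φ.nonneg_normed)]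
      refine lintegral_congr fun y => ?_
      rw [hd]; exact Real.enorm_of_nonneg (φ.nonneg_normed y)
    rw [h1, φ.integral_normed, ENNReal.ofReal_one]
  have hfx : AEStronglyMeasurable (fun y => f (x - y)) μ :=
    hf.comp_quasiMeasurePreserving (quasiMeasurePreserving_sub_left_of_right_invariant μ x)
  have hfx' : AEStronglyMeasurable (fun y => f (x - y)) (μ.withDensity d) :=
    hfx.mono_ac (withDensity_absolutelyContinuous μ d)
  have h2 := eLpNorm_le_eLpNorm_of_exponent_le (p := 1) (q := 2) (by norm_num) hfx'
  have h3 : eLpNorm (fun y => f (x - y)) 1 (μ.withDensity d) = ∫⁻ y, d y * ‖f (x - y)‖ₑ ∂μ := by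
    rw [eLpNorm_one_eq_lintegral_enorm,
      lintegral_withDensity_eq_lintegral_mul_non_measurable₀ _ hdm.aemeasurable
        (Eventually.of_forall fun y => by simp [hd])]
    rfl
  have h4 : eLpNorm (fun y => f (x - y)) 2 (μ.withDensity d) ^ 2 =
      ∫⁻ y, d y * ‖f (x - y)‖ₑ ^ 2 ∂μ := by
    rw [eLpNorm_two_sq,
      lintegral_withDensity_eq_lintegral_mul_non_measurable₀ _ hdm.aemeasurable
        (Eventually.of_forall fun y => by simp [hd])]
    rfl
  rw [← h4]
  refine pow_le_pow_left' (le_trans ?_ h2) 2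
  rw [h3, convolution_def]
  refine (enorm_integral_le_lintegral_enorm _).trans (le_of_eq (lintegral_congr fun y => ?_))
  rw [ContinuousLinearMap.lsmul_apply, enorm_smul]

theorem aestronglyMeasurable_normed_convolution (φ : ContDiffBump (0 : G)) {f : G → ℂ}
    (hf : LocallyIntegrable f μ) :
    AEStronglyMeasurable (φ.normed μ ⋆[ContinuousLinearMap.lsmul ℝ ℝ, μ] f) μ :=
  (φ.hasCompactSupport_normed.continuous_convolution_left _ φ.continuous_normed
    hf).aestronglyMeasurable

/-- Mollification does not increase the `L²` norm. -/
theorem eLpNorm_normed_convolution_le (φ : ContDiffBump (0 : G)) {f : G → ℂ}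
    (hf : AEStronglyMeasurable f μ) :
    eLpNorm (φ.normed μ ⋆[ContinuousLinearMap.lsmul ℝ ℝ, μ] f) 2 μ ≤ eLpNorm f 2 μ := by
  have key : eLpNorm (φ.normed μ ⋆[ContinuousLinearMap.lsmul ℝ ℝ, μ] f) 2 μ ^ 2 ≤
      eLpNorm f 2 μ ^ 2 := by
    rw [eLpNorm_two_sq, eLpNorm_two_sq]
    calc ∫⁻ x, ‖(φ.normed μ ⋆[ContinuousLinearMap.lsmul ℝ ℝ, μ] f) x‖ₑ ^ 2 ∂μ
        ≤ ∫⁻ x, ∫⁻ y, ‖φ.normed μ y‖ₑ * ‖f (x - y)‖ₑ ^ 2 ∂μ ∂μ :=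
          lintegral_mono fun x => enorm_normed_convolution_sq_le φ hf x
      _ = ∫⁻ y, ∫⁻ x, ‖φ.normed μ y‖ₑ * ‖f (x - y)‖ₑ ^ 2 ∂μ ∂μ := by
          refine lintegral_lintegral_swap ?_
          refine AEMeasurable.mul (M := ℝ≥0∞) (f := fun p : G × G => ‖φ.normed μ p.2‖ₑ)
            (g := fun p : G × G => ‖f (p.1 - p.2)‖ₑ ^ 2) ?_ ?_
          · exact (φ.continuous_normed.measurable.enorm.comp measurable_snd).aemeasurable
          · exact ((hf.comp_quasiMeasurePreserving
              (quasiMeasurePreserving_sub_of_right_invariant μ μ)).enorm).pow_const 2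
      _ = ∫⁻ y, ‖φ.normed μ y‖ₑ * ∫⁻ x, ‖f x‖ₑ ^ 2 ∂μ ∂μ := by
          refine lintegral_congr fun y => ?_
          rw [lintegral_const_mul' _ _ (by simp), lintegral_sub_right_eq_self (fun x => ‖f x‖ₑ ^ 2)]
      _ = ∫⁻ x, ‖f x‖ₑ ^ 2 ∂μ := by
          rw [lintegral_mul_const _ φ.continuous_normed.measurable.enorm]
          have h1 : ∫⁻ y, ‖φ.normed μ y‖ₑ ∂μ = ENNReal.ofReal (∫ y, φ.normed μ y ∂μ) := by
            rw [ofReal_integral_eq_lintegral_ofReal φ.integrable_normed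
              (Eventually.of_forall φ.nonneg_normed)]
            exact lintegral_congr fun y => Real.enorm_of_nonneg (φ.nonneg_normed y)
          rw [h1, φ.integral_normed, ENNReal.ofReal_one, one_mul]
  exact (ENNReal.pow_le_pow_left_iff two_ne_zero).1 key

/-- Mollifications of a continuous function with compact support converge in `L²`. -/
theorem tendsto_eLpNorm_normed_convolution_sub_of_continuous {φ : ℕ → ContDiffBump (0 : G)}
    (hφ : Tendsto (fun n => (φ n).rOut) atTop (𝓝 0)) {g : G → ℂ} (hg : Continuous g)
    (hgs : HasCompactSupport g) :
    Tendsto (fun n => eLpNorm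
      (((φ n).normed μ ⋆[ContinuousLinearMap.lsmul ℝ ℝ, μ] g) - g) 2 μ) atTop (𝓝 0) := by
  -- Once the mollifier has radius less than `1`, nothing leaves this compact set, so uniform
  -- closeness gives `L²` closeness.
  set K : Set G := Metric.cthickening 1 (tsupport g) with hK
  have hKc : IsCompact K := hgs.isCompact.cthickening
  have hKm : MeasurableSet K := hKc.isClosed.measurableSet
  rw [ENNReal.tendsto_nhds_zero]
  intro ε hε
  obtain ⟨δ, hδ, hδε⟩ : ∃ δ : ℝ, 0 < δ ∧ ENNReal.ofReal δ * μ K ^ (1 / (2 : ℝ)) ≤ ε := by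
    have hfin : μ K ^ (1 / (2 : ℝ)) ≠ ⊤ := ENNReal.rpow_ne_top_of_nonneg (by norm_num)
      hKc.measure_lt_top.ne
    rcases eq_or_ne ε ⊤ with rfl | hεt
    · exact ⟨1, one_pos, le_top⟩
    have hC : 0 ≤ (μ K ^ (1 / (2 : ℝ))).toReal := ENNReal.toReal_nonneg
    refine ⟨ε.toReal / ((μ K ^ (1 / (2 : ℝ))).toReal + 1), div_pos (ENNReal.toReal_pos hε.ne' hεt)
      (by linarith), ?_⟩
    rw [← ENNReal.ofReal_toReal hfin, ← ENNReal.ofReal_mul (by positivity)]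
    refine ENNReal.ofReal_le_of_le_toReal ?_
    rw [ENNReal.toReal_ofReal hC, div_mul_eq_mul_div, div_le_iff₀ (by linarith)]
    nlinarith [ENNReal.toReal_nonneg (a := ε)]
  have huc := hgs.uniformContinuous_of_continuous hg
  rw [Metric.uniformContinuous_iff] at huc
  obtain ⟨r, hr, hrδ⟩ := huc δ hδ
  filter_upwards [hφ.eventually (gt_mem_nhds (lt_min hr one_pos))] with n hn
  have hbound : ∀ x, ‖(((φ n).normed μ ⋆[ContinuousLinearMap.lsmul ℝ ℝ, μ] g) - g) x‖ ≤
      K.indicator (fun _ => δ) x := by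
    intro x
    have hd : dist (((φ n).normed μ ⋆[ContinuousLinearMap.lsmul ℝ ℝ, μ] g : G → ℂ) x) (g x) ≤
        K.indicator (fun _ => δ) x := by
      refine (φ n).dist_normed_convolution_le hg.aestronglyMeasurable fun y hy => ?_
      have hy' : dist y x < r := (Metric.mem_ball.1 hy).trans (hn.trans_le (min_le_left _ _))
      by_cases hx : x ∈ K
      · rw [Set.indicator_of_mem hx]
        exact (hrδ hy').le
      · have hx0 : g x = 0 := by
          by_contra h
          exact hx (Metric.self_subset_cthickening _ (subset_tsupport g h))
        have hy0 : g y = 0 := by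
          by_contra h
          refine hx (Metric.mem_cthickening_of_dist_le x y 1 _ (subset_tsupport g h) ?_)
          rw [dist_comm]
          exact ((Metric.mem_ball.1 hy).trans (hn.trans_le (min_le_right _ _))).le
        rw [Set.indicator_of_notMem hx, hx0, hy0, dist_self]
    rwa [dist_eq_norm] at hd
  refine (eLpNorm_mono_real hbound).trans ?_
  rw [eLpNorm_indicator_const hKm (by norm_num) (by norm_num)]
  simpa [Real.enorm_of_nonneg hδ.le] using hδε

/-- Mollifications of a square integrable function converge in `L²`. -/
theorem tendsto_eLpNorm_normed_convolution_sub {φ : ℕ → ContDiffBump (0 : G)}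
    (hφ : Tendsto (fun n => (φ n).rOut) atTop (𝓝 0)) {f : G → ℂ} (hf : MemLp f 2 μ) :
    Tendsto (fun n => eLpNorm
      (((φ n).normed μ ⋆[ContinuousLinearMap.lsmul ℝ ℝ, μ] f) - f) 2 μ) atTop (𝓝 0) := by
  rw [ENNReal.tendsto_nhds_zero]
  intro ε hε
  have hε3 : ε / 3 ≠ 0 := (ENNReal.div_pos hε.ne' (by norm_num)).ne'
  obtain ⟨g, hgs, hfg, hg, hgL⟩ := hf.exists_hasCompactSupport_eLpNorm_sub_le (by norm_num) hε3
  have hgl : LocallyIntegrable g μ := hg.locallyIntegrable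
  have hfl : LocallyIntegrable f μ := hf.locallyIntegrable (by norm_num)
  filter_upwards [(ENNReal.tendsto_nhds_zero.1
    (tendsto_eLpNorm_normed_convolution_sub_of_continuous (μ := μ) hφ hg hgs)) (ε / 3)
    (pos_iff_ne_zero.2 hε3)] with n hn
  set T : (G → ℂ) → G → ℂ := fun u => (φ n).normed μ ⋆[ContinuousLinearMap.lsmul ℝ ℝ, μ] u with hT
  have hsplit : T f - f = (T (f - g) + (T g - g)) + (g - f) := by
    have : T f = T (f - g) + T g := by
      ext x
      have hex : ∀ {u : G → ℂ}, LocallyIntegrable u μ → ConvolutionExistsAt ((φ n).normed μ) u x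
          (ContinuousLinearMap.lsmul ℝ ℝ) μ := fun hu =>
        (φ n).hasCompactSupport_normed.convolutionExists_left _ (φ n).continuous_normed hu x
      have h := (hex (hfl.sub hgl)).distrib_add (hex hgl)
      simp only [hT, Pi.add_apply]
      rw [← h, sub_add_cancel]
    rw [this]; abel
  have m1 : AEStronglyMeasurable (T (f - g)) μ :=
    aestronglyMeasurable_normed_convolution (φ n) (hfl.sub hgl)
  have m2 : AEStronglyMeasurable (T g - g) μ :=
    (aestronglyMeasurable_normed_convolution (φ n) hgl).sub hgL.1
  change eLpNorm (T f - f) 2 μ ≤ ε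
  rw [hsplit]
  calc eLpNorm ((T (f - g) + (T g - g)) + (g - f)) 2 μ
      ≤ eLpNorm (T (f - g)) 2 μ + eLpNorm (T g - g) 2 μ + eLpNorm (g - f) 2 μ :=
        (eLpNorm_add_le (m1.add m2) (hgL.1.sub hf.1) (by norm_num)).trans
          (add_le_add_left (eLpNorm_add_le m1 m2 (by norm_num)) _)
    _ ≤ ε / 3 + ε / 3 + ε / 3 := by
        refine add_le_add (add_le_add ?_ hn) ?_
        · exact (eLpNorm_normed_convolution_le (φ n) (hf.1.sub hgL.1)).trans hfg
        · rw [eLpNorm_sub_comm]; exact hfg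
    _ = ε := ENNReal.add_thirds ε

end Mollification

/-! ### Continuity of weighted square integrals on `L²`. -/

section QuadraticForms

open Filter Topology

/-- A quadratic form with bounded weight is continuous on `L²`. -/
theorem tendsto_integral_mul_norm_sq {α : Type*} [MeasurableSpace α] {μ : Measure α}
    {w : α → ℝ} {C : ℝ} (hw : AEStronglyMeasurable w μ) (hC : ∀ᵐ x ∂μ, |w x| ≤ C)
    {f : α → ℂ} {F : ℕ → α → ℂ} (hf : MemLp f 2 μ) (hF : ∀ n, MemLp (F n) 2 μ)
    (h : Tendsto (fun n => eLpNorm (F n - f) 2 μ) atTop (𝓝 0)) :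
    Tendsto (fun n => ∫ x, w x * ‖F n x‖ ^ 2 ∂μ) atTop (𝓝 (∫ x, w x * ‖f x‖ ^ 2 ∂μ)) := by
  have hint : ∀ {u : α → ℂ}, MemLp u 2 μ → Integrable (fun x => w x * ‖u x‖ ^ 2) μ := fun hu =>
    (hu.integrable_norm_pow (by norm_num)).bdd_mul hw (c := C)
      (by simpa [Real.norm_eq_abs] using hC)
  refine tendsto_integral_of_L1' _ (hint hf).1 (Eventually.of_forall fun n => hint (hF n)) ?_
  -- Hölder's inequality applied to `|‖a‖² - ‖b‖²| ≤ ‖a - b‖ (‖a - b‖ + 2 ‖b‖)`.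
  have hb : ∀ n, eLpNorm ((fun x => w x * ‖F n x‖ ^ 2) - fun x => w x * ‖f x‖ ^ 2) 1 μ ≤
      ENNReal.ofReal C * (eLpNorm (F n - f) 2 μ *
        (eLpNorm (F n - f) 2 μ + 2 * eLpNorm f 2 μ)) := by
    intro n
    have m1 : AEStronglyMeasurable (fun x => ‖(F n - f) x‖) μ := ((hF n).1.sub hf.1).norm
    have m2 : AEStronglyMeasurable (fun x => ‖(F n - f) x‖ + 2 * ‖f x‖) μ :=
      m1.add (hf.1.norm.const_mul 2)
    have e1 : eLpNorm ((fun x => w x * ‖F n x‖ ^ 2) - fun x => w x * ‖f x‖ ^ 2) 1 μ ≤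
        ENNReal.ofReal C * eLpNorm ((fun x => ‖(F n - f) x‖) •
          fun x => ‖(F n - f) x‖ + 2 * ‖f x‖) 1 μ := by
      refine eLpNorm_le_mul_eLpNorm_of_ae_le_mul ?_ 1
      filter_upwards [hC] with x hx
      have hC0 : 0 ≤ C := (abs_nonneg _).trans hx
      simp only [Pi.sub_apply, Pi.smul_apply', smul_eq_mul, Real.norm_eq_abs]
      rw [← mul_sub, abs_mul, abs_of_nonneg (a := ‖F n x - f x‖ * _) (by positivity)]
      refine mul_le_mul hx ?_ (abs_nonneg _) hC0
      have t1 := abs_norm_sub_norm_le (F n x) (f x)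
      have t2 : |‖F n x‖ ^ 2 - ‖f x‖ ^ 2| = |‖F n x‖ - ‖f x‖| * (‖F n x‖ + ‖f x‖) := by
        rw [sq_sub_sq, abs_mul, abs_of_nonneg (a := ‖F n x‖ + ‖f x‖) (by positivity), mul_comm]
      rw [t2]
      have t3 : ‖F n x‖ ≤ ‖F n x - f x‖ + ‖f x‖ := by
        simpa using norm_add_le (F n x - f x) (f x)
      exact mul_le_mul t1 (by linarith) (by positivity) (norm_nonneg _)
    refine e1.trans ?_
    gcongr
    refine (eLpNorm_smul_le_mul_eLpNorm (p := 2) (q := 2) (r := 1) m2 m1).trans ?_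
    rw [eLpNorm_norm]
    gcongr
    refine (eLpNorm_add_le (f := fun x => ‖(F n - f) x‖) m1 (hf.1.norm.const_mul 2)
      (by norm_num)).trans ?_
    rw [eLpNorm_norm]
    gcongr
    refine (eLpNorm_const_smul_le (c := (2 : ℝ)) (f := fun x => ‖f x‖)).trans ?_
    rw [eLpNorm_norm]
    refine le_of_eq ?_
    rw [Real.enorm_of_nonneg (by norm_num)]
    norm_num
  refine tendsto_of_tendsto_of_tendsto_of_le_of_le tendsto_const_nhds ?_ (fun _ => zero_le) hb
  have hfin : eLpNorm f 2 μ ≠ ⊤ := hf.2.ne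
  have l1 : Tendsto (fun n => eLpNorm (F n - f) 2 μ + 2 * eLpNorm f 2 μ) atTop
      (𝓝 (0 + 2 * eLpNorm f 2 μ)) := h.add tendsto_const_nhds
  have l2 := ENNReal.Tendsto.mul h (Or.inr (ENNReal.add_ne_top.2 ⟨ENNReal.zero_ne_top,
    ENNReal.mul_ne_top (by norm_num) hfin⟩)) l1 (Or.inr ENNReal.zero_ne_top)
  have l3 := ENNReal.Tendsto.const_mul (a := ENNReal.ofReal C) l2 (Or.inr ENNReal.ofReal_ne_top)
  simpa using l3

end QuadraticForms

/-! ### Approximation of `H¹` functions by `C¹` functions. -/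

section Regularization

open Filter Topology
open scoped Convolution

instance (N : ℕ) : (volume : Measure (Config N)).IsNegInvariant := Measure.pi.isNegInvariant _

/-- The partial derivative in the `a`-th coordinate of the `k`-th particle. -/
def partialDeriv {N : ℕ} (F : Config N → ℂ) (k : Fin N) (a : Fin 3) (x : Config N) : ℂ :=
  fderiv ℝ F x (Pi.single k (EuclideanSpace.single a 1))

/-- Mollification turns weak derivatives into derivatives. -/
theorem HasWeakPartial.partialDeriv_normed_convolution {N : ℕ} {Ψ g : Config N → ℂ} {k : Fin N}
    {a : Fin 3} (h : HasWeakPartial Ψ g k a) (hΨ : LocallyIntegrable Ψ volume)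
    (φ : ContDiffBump (0 : Config N)) :
    partialDeriv (φ.normed volume ⋆[ContinuousLinearMap.lsmul ℝ ℝ, volume] Ψ) k a =
      (φ.normed volume ⋆[ContinuousLinearMap.lsmul ℝ ℝ, volume] g) := by
  ext x
  set v : Config N := Pi.single k (EuclideanSpace.single a 1) with hv
  have hρ : ContDiff ℝ ∞ (φ.normed (volume : Measure (Config N))) := φ.contDiff_normed
  have hρ1 : ContDiff ℝ 1 (φ.normed (volume : Measure (Config N))) := φ.contDiff_normed
  have hρc := φ.hasCompactSupport_normed (μ := (volume : Measure (Config N)))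
  have hd := hρc.hasFDerivAt_convolution_left (ContinuousLinearMap.lsmul ℝ ℝ) hρ1 hΨ x
  have hex : ConvolutionExistsAt (fderiv ℝ (φ.normed volume)) Ψ x
      ((ContinuousLinearMap.lsmul ℝ ℝ).precompL (Config N)) volume :=
    (hρc.fderiv ℝ).convolutionExists_left _ (hρ1.continuous_fderiv one_ne_zero) hΨ x
  rw [partialDeriv, hd.fderiv, convolution_def, ContinuousLinearMap.integral_apply hex,
    convolution_eq_swap]
  simp only [ContinuousLinearMap.precompL_apply, ContinuousLinearMap.lsmul_apply]
  rw [← integral_sub_left_eq_self _ volume x]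
  simp only [sub_sub_cancel]
  -- The reflected bump is the test function for the weak derivative; the sign from the reflection
  -- cancels the sign from integration by parts.
  have hη : ContDiff ℝ ∞ (fun z => φ.normed volume (x - z)) := hρ.comp (contDiff_const.sub contDiff_id)
  have hηc : HasCompactSupport (fun z => φ.normed volume (x - z)) :=
    hρc.comp_homeomorph (Homeomorph.subLeft x)
  have hw := h _ hη hηc
  have hfd : ∀ z, fderiv ℝ (fun z => φ.normed volume (x - z)) z v =
      - fderiv ℝ (φ.normed volume) (x - z) v := by
    intro z
    have := ((hρ1.differentiable one_ne_zero (x - z)).hasFDerivAt.comp z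
      ((hasFDerivAt_id z).const_sub x)).fderiv
    simp only [Function.comp_def] at this
    rw [this]
    simp
  simp only [← hv, hfd, neg_smul, integral_neg, neg_inj] at hw
  exact hw

/-- `H¹` functions are limits of continuously differentiable ones. -/
theorem IsH1.exists_approx {N : ℕ} {Ψ : Config N → ℂ} {D : Fin N → Fin 3 → Config N → ℂ}
    (h : IsH1 Ψ D) :
    ∃ F : ℕ → Config N → ℂ, (∀ n, ContDiff ℝ 1 (F n)) ∧ (∀ n, MemLp (F n) 2 volume) ∧
      (∀ n k a, MemLp (partialDeriv (F n) k a) 2 volume) ∧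
      Tendsto (fun n => eLpNorm (F n - Ψ) 2 volume) atTop (𝓝 0) ∧
      ∀ k a, Tendsto (fun n => eLpNorm (partialDeriv (F n) k a - D k a) 2 volume) atTop (𝓝 0) := by
  set φ : ℕ → ContDiffBump (0 : Config N) := fun n =>
    ⟨1 / ((n : ℝ) + 1) / 2, 1 / ((n : ℝ) + 1), by positivity, half_lt_self (by positivity)⟩ with hφ
  have hφt : Tendsto (fun n => (φ n).rOut) atTop (𝓝 0) := tendsto_one_div_add_atTop_nhds_zero_nat
  have hl := h.memLp.locallyIntegrable (by norm_num)
  have hmem : ∀ n {u : Config N → ℂ}, MemLp u 2 volume →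
      MemLp ((φ n).normed volume ⋆[ContinuousLinearMap.lsmul ℝ ℝ, volume] u) 2 volume :=
    fun n u hu => ⟨aestronglyMeasurable_normed_convolution (φ n)
      (hu.locallyIntegrable (by norm_num)), (eLpNorm_normed_convolution_le (φ n) hu.1).trans_lt hu.2⟩
  have hpd := fun n k a => (h.weak k a).partialDeriv_normed_convolution hl (φ n)
  refine ⟨fun n => (φ n).normed volume ⋆[ContinuousLinearMap.lsmul ℝ ℝ, volume] Ψ,
    fun n => (φ n).hasCompactSupport_normed.contDiff_convolution_left _ (φ n).contDiff_normed hl,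
    fun n => hmem n h.memLp, fun n k a => ?_,
    tendsto_eLpNorm_normed_convolution_sub hφt h.memLp, fun k a => ?_⟩
  · rw [hpd]; exact hmem n (h.memLp_grad k a)
  · simp only [hpd]
    exact tendsto_eLpNorm_normed_convolution_sub hφt (h.memLp_grad k a)

end Regularization

/-! ### The energy inequality in a ball for arbitrary `C¹` functions. -/

section BallInequality

open Filter Topology

/-- The squared length of a linear map on a vector of the unit ball is at most its squared
Hilbert–Schmidt norm. -/
theorem norm_sq_apply_le_sum (L : R3 →L[ℝ] ℂ) (v : R3) :
    ‖L v‖ ^ 2 ≤ ‖v‖ ^ 2 * ∑ a : Fin 3, ‖L (EuclideanSpace.single a 1)‖ ^ 2 := by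
  have h1 : L v = ∑ a : Fin 3, v a • L (EuclideanSpace.single a 1) := by
    conv_lhs => rw [← (EuclideanSpace.basisFun (Fin 3) ℝ).sum_repr v]
    simp [map_sum]
  have h2 : ‖L v‖ ≤ ∑ a : Fin 3, |v a| * ‖L (EuclideanSpace.single a 1)‖ := by
    rw [h1]
    refine (norm_sum_le _ _).trans (le_of_eq (Finset.sum_congr rfl fun a _ => ?_))
    rw [norm_smul, Real.norm_eq_abs]
  calc ‖L v‖ ^ 2 ≤ (∑ a : Fin 3, |v a| * ‖L (EuclideanSpace.single a 1)‖) ^ 2 := by gcongr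
    _ ≤ (∑ a : Fin 3, |v a| ^ 2) * ∑ a : Fin 3, ‖L (EuclideanSpace.single a 1)‖ ^ 2 :=
        Finset.sum_mul_sq_le_sq_mul_sq _ _ _
    _ = ‖v‖ ^ 2 * ∑ a : Fin 3, ‖L (EuclideanSpace.single a 1)‖ ^ 2 := by
        rw [EuclideanSpace.norm_sq_eq]; simp

theorem gradSq_nonneg (φ : R3 → ℂ) (x : R3) : 0 ≤ gradSq φ x :=
  Finset.sum_nonneg fun _ _ => by positivity

theorem continuous_gradSq {φ : R3 → ℂ} (hφ : ContDiff ℝ 1 φ) : Continuous (gradSq φ) :=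
  continuous_finsetSum _ fun _ _ =>
    ((hφ.continuous_fderiv one_ne_zero).clm_apply continuous_const).norm.pow 2

/-- The energy in a ball with a bounded radial weight is nonnegative if it is so on functions which
equal `1` on the boundary: the first case is that of functions that are constant on the boundary. -/
theorem energy_nonneg_of_const_on_sphere {W : R3 → ℝ} {R : ℝ}
    (H : ∀ φ : R3 → ℂ, ContDiff ℝ 1 φ → (∀ x : R3, ‖x‖ = R → φ x = 1) →
      0 ≤ ∫ x in Metric.ball (0 : R3) R, (gradSq φ x + W x * ‖φ x‖ ^ 2))
    {φ : R3 → ℂ} (hφ : ContDiff ℝ 1 φ) {c : ℂ} (hc : c ≠ 0) (hφc : ∀ x : R3, ‖x‖ = R → φ x = c) :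
    0 ≤ ∫ x in Metric.ball (0 : R3) R, (gradSq φ x + W x * ‖φ x‖ ^ 2) := by
  have h := H (fun x => c⁻¹ * φ x) (contDiff_const.mul hφ) fun x hx => by
    rw [hφc x hx, inv_mul_cancel₀ hc]
  have e : ∀ x, gradSq (fun x => c⁻¹ * φ x) x + W x * ‖c⁻¹ * φ x‖ ^ 2 =
      (‖c‖ ^ 2)⁻¹ * (gradSq φ x + W x * ‖φ x‖ ^ 2) := by
    intro x
    have hd : fderiv ℝ (fun x => c⁻¹ * φ x) x = c⁻¹ • fderiv ℝ φ x :=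
      fderiv_const_mul (hφ.differentiable one_ne_zero x) c⁻¹
    simp only [gradSq, hd, smul_apply, smul_eq_mul, norm_mul, norm_inv,
      mul_pow, ← Finset.mul_sum, inv_pow]
    ring
  simp only [e, integral_const_mul] at h
  have hc2 : 0 < (‖c‖ ^ 2)⁻¹ := by positivity
  exact nonneg_of_mul_nonneg_right h hc2

/-- The gradient of a regularized radial function. -/
theorem gradSq_radial_le {f : ℝ → ℂ} (hf : ContDiff ℝ 1 f) {δ : ℝ} (hδ : 0 < δ) (η : ℂ) (x : R3) :
    gradSq (fun x => f (√(‖x‖ ^ 2 + δ ^ 2)) + η) x ≤ ‖deriv f (√(‖x‖ ^ 2 + δ ^ 2))‖ ^ 2 := by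
  set s := √(‖x‖ ^ 2 + δ ^ 2) with hs
  have hpos : 0 < ‖x‖ ^ 2 + δ ^ 2 := by positivity
  have hs0 : 0 < s := Real.sqrt_pos.2 hpos
  have hs2 : s ^ 2 = ‖x‖ ^ 2 + δ ^ 2 := Real.sq_sqrt hpos.le
  have h1 := ((hasStrictFDerivAt_norm_sq x).hasFDerivAt.add_const (δ ^ 2)).sqrt hpos.ne'
  have h2 := ((hf.differentiable one_ne_zero s).hasDerivAt.hasFDerivAt.comp x h1).add_const η
  have hd : ∀ v, fderiv ℝ (fun x => f (√(‖x‖ ^ 2 + δ ^ 2)) + η) x v =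
      (s⁻¹ * inner ℝ x v) • deriv f s := by
    intro v
    have h3 := h2.fderiv
    simp only [Function.comp_def] at h3
    rw [h3]
    simp [← hs]
    field_simp
  simp only [gradSq, hd, norm_smul, mul_pow, ← Finset.sum_mul, Real.norm_eq_abs, sq_abs,
    ← Finset.mul_sum]
  have hx : ∑ a : Fin 3, inner ℝ x (EuclideanSpace.single a (1 : ℝ)) ^ 2 = ‖x‖ ^ 2 := by
    rw [EuclideanSpace.norm_sq_eq]
    refine Finset.sum_congr rfl fun a _ => ?_
    simp [EuclideanSpace.inner_single_right]
  rw [hx]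
  -- The regularized radius has gradient of length `‖x‖ / s ≤ 1`.
  have : (s⁻¹) ^ 2 * ‖x‖ ^ 2 ≤ 1 := by
    rw [inv_pow, inv_mul_le_iff₀ (by positivity), hs2]
    nlinarith
  nlinarith [sq_nonneg ‖deriv f s‖]

variable {W : R3 → ℝ} {R C : ℝ}

/-- The case of radial functions. -/
theorem energy_nonneg_of_radial (hW : AEStronglyMeasurable W volume) (hC : ∀ᵐ x, |W x| ≤ C)
    (H : ∀ φ : R3 → ℂ, ContDiff ℝ 1 φ → (∀ x : R3, ‖x‖ = R → φ x = 1) →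
      0 ≤ ∫ x in Metric.ball (0 : R3) R, (gradSq φ x + W x * ‖φ x‖ ^ 2))
    {f : ℝ → ℂ} (hf : ContDiff ℝ 1 f) :
    0 ≤ ∫ x in Metric.ball (0 : R3) R, (‖deriv f ‖x‖‖ ^ 2 + W x * ‖f ‖x‖‖ ^ 2) := by
  have hdf : Continuous (deriv f) := hf.continuous_deriv le_rfl
  set δ : ℕ → ℝ := fun n => 1 / ((n : ℝ) + 1) with hδ
  have hδpos : ∀ n, 0 < δ n := fun n => by positivity
  have hδ1 : ∀ n, δ n ≤ 1 := fun n => by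
    rw [hδ]; simp only; rw [div_le_one (by positivity)]; linarith [(n.cast_nonneg : (0:ℝ) ≤ n)]
  have hδt : Tendsto δ atTop (𝓝 0) := tendsto_one_div_add_atTop_nhds_zero_nat
  -- The boundary value must be nonzero to be normalized. A shift by `δ n` or by `2 δ n` achieves
  -- this, since both cannot fail.
  have hη : ∀ n, ∃ η : ℂ, ‖η‖ ≤ 2 * δ n ∧ f (√(R ^ 2 + δ n ^ 2)) + η ≠ 0 := by
    intro n
    by_cases h : f (√(R ^ 2 + δ n ^ 2)) + (δ n : ℂ) = 0
    · refine ⟨2 * (δ n : ℂ), by simp [abs_of_pos (hδpos n)], ?_⟩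
      rw [two_mul, ← add_assoc, h, zero_add]
      exact_mod_cast (hδpos n).ne'
    · refine ⟨(δ n : ℂ), ?_, h⟩
      rw [Complex.norm_real, Real.norm_of_nonneg (hδpos n).le]
      linarith [hδpos n]
  choose η hη2 hη0 using hη
  have hηt : Tendsto η atTop (𝓝 0) :=
    squeeze_zero_norm hη2 (by simpa using hδt.const_mul 2)
  -- Replacing `‖x‖` by `√(‖x‖² + δ²)` removes the singularity at the origin and keeps the function
  -- constant on spheres.
  set s : ℕ → R3 → ℝ := fun n x => √(‖x‖ ^ 2 + δ n ^ 2) with hs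
  have hscont : ∀ n, Continuous (s n) := fun n => by fun_prop
  set G : ℕ → R3 → ℝ := fun n x => ‖deriv f (s n x)‖ ^ 2 + W x * ‖f (s n x) + η n‖ ^ 2 with hG
  obtain ⟨M, hM⟩ := (isCompact_Icc (a := 0) (b := √(R ^ 2 + 1))).exists_bound_of_continuousOn
    hf.continuous.continuousOn
  obtain ⟨M', hM'⟩ := (isCompact_Icc (a := 0) (b := √(R ^ 2 + 1))).exists_bound_of_continuousOn
    hdf.continuousOn
  have hsI : ∀ n, ∀ x ∈ Metric.ball (0 : R3) R, s n x ∈ Set.Icc 0 (√(R ^ 2 + 1)) := by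
    intro n x hx
    have hx' : ‖x‖ < R := by simpa using hx
    refine ⟨Real.sqrt_nonneg _, Real.sqrt_le_sqrt ?_⟩
    nlinarith [norm_nonneg x, hδ1 n, hδpos n]
  have hGm : ∀ n, AEStronglyMeasurable (G n) (volume.restrict (Metric.ball (0 : R3) R)) := by
    intro n
    refine ((hdf.comp (hscont n)).norm.pow 2).aestronglyMeasurable.add
      (hW.restrict.mul (((hf.continuous.comp (hscont n)).add
        continuous_const).norm.pow 2).aestronglyMeasurable)
  have hGb : ∀ n, ∀ᵐ x ∂(volume.restrict (Metric.ball (0 : R3) R)),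
      ‖G n x‖ ≤ M' ^ 2 + C * (M + 2) ^ 2 := by
    intro n
    filter_upwards [ae_restrict_mem measurableSet_ball, ae_restrict_of_ae hC] with x hx hCx
    have b1 := hM _ (hsI n x hx)
    have b2 := hM' _ (hsI n x hx)
    have b3 : ‖f (s n x) + η n‖ ≤ M + 2 :=
      (norm_add_le _ _).trans (add_le_add b1 ((hη2 n).trans (by linarith [hδ1 n])))
    have hC0 : 0 ≤ C := (abs_nonneg _).trans hCx
    rw [Real.norm_eq_abs]
    refine (abs_add_le _ _).trans (add_le_add ?_ ?_)
    · rw [abs_of_nonneg (by positivity)]; gcongr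
    · rw [abs_mul, abs_of_nonneg (a := ‖f (s n x) + η n‖ ^ 2) (by positivity)]; gcongr
  have hfin : IsFiniteMeasure (volume.restrict (Metric.ball (0 : R3) R)) :=
    ⟨by rw [Measure.restrict_apply_univ]; exact measure_ball_lt_top⟩
  have hlim : Tendsto (fun n => ∫ x in Metric.ball (0 : R3) R, G n x) atTop
      (𝓝 (∫ x in Metric.ball (0 : R3) R, (‖deriv f ‖x‖‖ ^ 2 + W x * ‖f ‖x‖‖ ^ 2))) := by
    refine tendsto_integral_of_dominated_convergence (fun _ => M' ^ 2 + C * (M + 2) ^ 2) hGm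
      (integrable_const _) hGb (Eventually.of_forall fun x => ?_)
    have hst : Tendsto (fun n => s n x) atTop (𝓝 ‖x‖) := by
      have : Tendsto (fun n => s n x) atTop (𝓝 (√(‖x‖ ^ 2 + 0 ^ 2))) :=
        (Real.continuous_sqrt.tendsto _).comp (tendsto_const_nhds.add (hδt.pow 2))
      simpa using this
    have t1 := ((hdf.tendsto _).comp hst).norm.pow 2
    have t2 := ((((hf.continuous.tendsto _).comp hst).add hηt).norm.pow 2).const_mul (W x)
    simpa using t1.add t2
  refine ge_of_tendsto' hlim fun n => ?_
  have hcd : ContDiff ℝ 1 (fun x : R3 => f (√(‖x‖ ^ 2 + δ n ^ 2)) + η n) := by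
    refine (hf.comp (ContDiff.sqrt ((contDiff_norm_sq ℝ).add contDiff_const) fun x => ?_)).add
      contDiff_const
    have := hδpos n
    positivity
  have hn := energy_nonneg_of_const_on_sphere H hcd (hη0 n) fun x hx => by rw [hx]
  refine hn.trans (integral_mono_ae ?_ ?_ ?_)
  · have i1 : IntegrableOn (gradSq (fun x : R3 => f (√(‖x‖ ^ 2 + δ n ^ 2)) + η n))
        (Metric.ball 0 R) volume :=
      ((continuous_gradSq hcd).continuousOn.integrableOn_compact
        (isCompact_closedBall (0 : R3) R)).mono_set Metric.ball_subset_closedBall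
    have i2 : IntegrableOn (fun x : R3 => ‖f (√(‖x‖ ^ 2 + δ n ^ 2)) + η n‖ ^ 2)
        (Metric.ball 0 R) volume :=
      ((hcd.continuous.norm.pow 2).continuousOn.integrableOn_compact
        (isCompact_closedBall (0 : R3) R)).mono_set Metric.ball_subset_closedBall
    exact i1.add (Integrable.bdd_mul (c := C) i2 hW.restrict
      (by simpa [Real.norm_eq_abs] using ae_restrict_of_ae hC))
  · exact Integrable.of_bound (hGm n) _ (hGb n)
  · exact Eventually.of_forall fun x => add_le_add_left (gradSq_radial_le hf (hδpos n) (η n) x) _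

/-- Integration in polar coordinates. -/
theorem integral_polar (G : R3 → ℝ) :
    ∫ x, G x = ∫ p : Metric.sphere (0 : R3) 1 × Set.Ioi (0 : ℝ), G (p.2.1 • p.1.1)
      ∂((volume : Measure R3).toSphere.prod
        (Measure.volumeIoiPow (Module.finrank ℝ R3 - 1))) := by
  have h := (volume : Measure R3).measurePreserving_homeomorphUnitSphereProd.integral_comp
    (Homeomorph.measurableEmbedding _)
    (fun p : Metric.sphere (0 : R3) 1 × Set.Ioi (0 : ℝ) => G (p.2.1 • p.1.1))
  rw [← h]
  have h2 : ∀ x : ({0}ᶜ : Set R3), G (((homeomorphUnitSphereProd R3 x).2 : ℝ) •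
      ((homeomorphUnitSphereProd R3 x).1 : R3)) = G x := by
    intro x
    have hx : ‖(x : R3)‖ ≠ 0 := norm_ne_zero_iff.2 x.2
    simp [smul_smul, hx]
  simp only [h2]
  rw [integral_subtype_comap (measurableSet_singleton _).compl G, restrict_compl_singleton]

/-- A bounded radial weight for which the energy in a ball is nonnegative on functions that equal
`1` on the boundary has nonnegative energy on all functions. -/
theorem energy_nonneg (hW : AEStronglyMeasurable W volume) (hC : ∀ᵐ x, |W x| ≤ C)
    (hrad : ∀ x y : R3, ‖x‖ = ‖y‖ → W x = W y)
    (H : ∀ φ : R3 → ℂ, ContDiff ℝ 1 φ → (∀ x : R3, ‖x‖ = R → φ x = 1) →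
      0 ≤ ∫ x in Metric.ball (0 : R3) R, (gradSq φ x + W x * ‖φ x‖ ^ 2))
    {φ : R3 → ℂ} (hφ : ContDiff ℝ 1 φ) :
    0 ≤ ∫ x in Metric.ball (0 : R3) R, (gradSq φ x + W x * ‖φ x‖ ^ 2) := by
  -- Only the radial derivative is kept, so that different directions decouple. At the origin the
  -- convention `0⁻¹ = 0` gives the value `0`, which is harmless.
  set A : R3 → ℝ := fun x => ‖fderiv ℝ φ x (‖x‖⁻¹ • x)‖ ^ 2 with hA
  have hφd := hφ.continuous_fderiv one_ne_zero
  have hAle : ∀ x, A x ≤ gradSq φ x := by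
    intro x
    have h1 := norm_sq_apply_le_sum (fderiv ℝ φ x) (‖x‖⁻¹ • x)
    have h2 : ‖‖x‖⁻¹ • x‖ ≤ 1 := by
      rw [norm_smul, norm_inv, norm_norm]; exact inv_mul_le_one
    calc A x ≤ ‖‖x‖⁻¹ • x‖ ^ 2 * gradSq φ x := h1
      _ ≤ 1 * gradSq φ x := by
          refine mul_le_mul_of_nonneg_right ?_ (gradSq_nonneg φ x)
          nlinarith [norm_nonneg (‖x‖⁻¹ • x)]
      _ = gradSq φ x := one_mul _
  have i1 : IntegrableOn (gradSq φ) (Metric.ball 0 R) volume :=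
    ((continuous_gradSq hφ).continuousOn.integrableOn_compact
      (isCompact_closedBall (0 : R3) R)).mono_set Metric.ball_subset_closedBall
  have i2 : IntegrableOn (fun x : R3 => W x * ‖φ x‖ ^ 2) (Metric.ball 0 R) volume := by
    have : IntegrableOn (fun x : R3 => ‖φ x‖ ^ 2) (Metric.ball 0 R) volume :=
      ((hφ.continuous.norm.pow 2).continuousOn.integrableOn_compact
        (isCompact_closedBall (0 : R3) R)).mono_set Metric.ball_subset_closedBall
    exact Integrable.bdd_mul (c := C) this hW.restrict
      (by simpa [Real.norm_eq_abs] using ae_restrict_of_ae hC)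
  have i3 : IntegrableOn A (Metric.ball 0 R) volume := by
    refine Integrable.mono' i1 ?_ (Eventually.of_forall fun x => ?_)
    · have hm : Measurable (fun x : R3 => (fderiv ℝ φ x, ‖x‖⁻¹ • x)) := by
        refine hφd.measurable.prodMk ?_
        exact (measurable_norm.inv).smul measurable_id
      have hc : Continuous (fun p : (R3 →L[ℝ] ℂ) × R3 => ‖p.1 p.2‖ ^ 2) := by fun_prop
      exact (hc.measurable.comp hm).aestronglyMeasurable
    · rw [Real.norm_of_nonneg (by positivity)]; exact hAle x
  suffices h : 0 ≤ ∫ x in Metric.ball (0 : R3) R, (A x + W x * ‖φ x‖ ^ 2) from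
    h.trans (integral_mono (i3.add i2) (i1.add i2) fun x => add_le_add_left (hAle x) _)
  rw [← integral_indicator measurableSet_ball, integral_polar]
  by_cases hint : Integrable (fun p : Metric.sphere (0 : R3) 1 × Set.Ioi (0 : ℝ) =>
      (Metric.ball (0 : R3) R).indicator (fun x => A x + W x * ‖φ x‖ ^ 2) (p.2.1 • p.1.1))
      ((volume : Measure R3).toSphere.prod (Measure.volumeIoiPow (Module.finrank ℝ R3 - 1)))
  swap
  -- A non-integrable function has integral `0` by convention, so this case needs no argument.
  · rw [integral_undef hint]
  rw [integral_prod _ hint]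
  refine integral_nonneg fun (θ : Metric.sphere (0 : R3) 1) => ?_
  have hθ : ‖θ.1‖ = 1 := mem_sphere_zero_iff_norm.1 θ.2
  have hf : ContDiff ℝ 1 (fun r : ℝ => φ (r • θ.1)) :=
    hφ.comp (contDiff_id.smul contDiff_const)
  -- The values of `φ` on the ray through `θ` are spread radially over the whole ball. As `W` is
  -- radial, the resulting energy is the ray integral times the area of the unit sphere.
  have hr := energy_nonneg_of_radial hW hC H hf
  rw [← integral_indicator measurableSet_ball, integral_polar] at hr
  set g : ℝ → ℝ := fun r => (Metric.ball (0 : R3) R).indicator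
    (fun x => A x + W x * ‖φ x‖ ^ 2) (r • θ.1) with hg
  have hcongr : ∀ p : Metric.sphere (0 : R3) 1 × Set.Ioi (0 : ℝ),
      (Metric.ball (0 : R3) R).indicator (fun x => ‖deriv (fun r : ℝ => φ (r • θ.1)) ‖x‖‖ ^ 2 +
        W x * ‖φ (‖x‖ • θ.1)‖ ^ 2) (p.2.1 • p.1.1) = g p.2.1 := by
    intro p
    have hp : 0 < p.2.1 := p.2.2
    have hp1 : ‖p.1.1‖ = 1 := mem_sphere_zero_iff_norm.1 p.1.2
    have n1 : ‖p.2.1 • p.1.1‖ = p.2.1 := by rw [norm_smul, hp1, mul_one, Real.norm_of_nonneg hp.le]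
    have n2 : ‖p.2.1 • θ.1‖ = p.2.1 := by rw [norm_smul, hθ, mul_one, Real.norm_of_nonneg hp.le]
    have hder : deriv (fun r : ℝ => φ (r • θ.1)) p.2.1 = fderiv ℝ φ (p.2.1 • θ.1) θ.1 := by
      have h1 : HasDerivAt (fun r : ℝ => r • θ.1) ((1 : ℝ) • θ.1) p.2.1 :=
        (hasDerivAt_id p.2.1).smul_const θ.1
      rw [one_smul] at h1
      exact ((hφ.differentiable one_ne_zero _).hasFDerivAt.comp_hasDerivAt _ h1).deriv
    have hu : (p.2.1)⁻¹ • p.2.1 • θ.1 = θ.1 := by rw [smul_smul, inv_mul_cancel₀ hp.ne', one_smul]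
    have hball : p.2.1 • p.1.1 ∈ Metric.ball (0 : R3) R ↔ p.2.1 • θ.1 ∈ Metric.ball (0 : R3) R := by
      simp only [mem_ball_zero_iff, n1, n2]
    have hWe : W (p.2.1 • p.1.1) = W (p.2.1 • θ.1) := hrad _ _ (n1.trans n2.symm)
    by_cases hb : p.2.1 • θ.1 ∈ Metric.ball (0 : R3) R
    · simp only [hg, Set.indicator_of_mem hb, Set.indicator_of_mem (hball.2 hb), hA, n1, n2, hWe,
        hder, hu]
    · simp only [hg, Set.indicator_of_notMem hb, Set.indicator_of_notMem (mt hball.1 hb)]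
  simp only [hcongr] at hr
  rw [integral_fun_snd (fun r : Set.Ioi (0 : ℝ) => g r.1), smul_eq_mul] at hr
  have hS : 0 < (volume : Measure R3).toSphere.real Set.univ := by
    rw [Measure.real, ENNReal.toReal_pos_iff]
    exact ⟨pos_iff_ne_zero.2 (by
      rw [Measure.measure_univ_ne_zero]; exact Measure.toSphere_ne_zero _), measure_lt_top _ _⟩
  exact nonneg_of_mul_nonneg_right hr hS

end BallInequality

/-! ### Counting pairs of points in sparse and crowded cells. -/

section Clusters

/-- The cell of the `i`-th point holds at most four points other than the `j`-th. -/
def SparseCell {ι κ : Type*} [Fintype ι] [DecidableEq ι] [DecidableEq κ] (c : ι → κ) (j i : ι) :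
    Prop :=
  (Finset.univ.filter fun k => k ≠ j ∧ c k = c i).card ≤ 4

instance {ι κ : Type*} [Fintype ι] [DecidableEq ι] [DecidableEq κ] (c : ι → κ) (j i : ι) :
    Decidable (SparseCell c j i) :=
  inferInstanceAs (Decidable (_ ≤ _))

/-- In a sum over pairs of neighbouring cells of which the first is crowded, the product of the
occupation numbers may be replaced by the square of the first one. -/
theorem sum_crowded_mul_le {κ : Type*} (Cs : Finset κ) (m : κ → ℝ) (hm : ∀ c, 0 ≤ m c)
    (near : κ → κ → Prop) [DecidableRel near] (hsymm : ∀ a b, near a b → near b a) :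
    ∑ a ∈ Cs, ∑ b ∈ Cs, (if near a b ∧ 5 ≤ m a then m a * m b else 0) ≤
      ∑ a ∈ Cs, ∑ b ∈ Cs, (if near a b ∧ 5 ≤ m a then m a ^ 2 else 0) := by
  set t : κ → κ → ℝ := fun a b => if near a b ∧ 5 ≤ m a then m a * m b else 0 with ht
  set r : κ → κ → ℝ := fun a b => if near a b ∧ 5 ≤ m a then m a ^ 2 else 0 with hr
  have key : ∀ a b, t a b + t b a ≤ r a b + r b a := by
    intro a b
    have hab : near b a ↔ near a b := ⟨hsymm b a, hsymm a b⟩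
    simp only [ht, hr, hab]
    have ha := hm a
    have hb := hm b
    by_cases h : near a b
    -- If both cells are crowded, this is `2ab ≤ a² + b²`; if only one is, its occupation number is
    -- the larger one.
    · by_cases h1 : 5 ≤ m a <;> by_cases h2 : 5 ≤ m b <;> simp only [h, h1, h2, and_self, and_false,
        if_true, if_false] <;> nlinarith [sq_nonneg (m a - m b)]
    · simp [h]
  have h1 : ∑ a ∈ Cs, ∑ b ∈ Cs, t b a = ∑ a ∈ Cs, ∑ b ∈ Cs, t a b := Finset.sum_comm
  have h2 : ∑ a ∈ Cs, ∑ b ∈ Cs, r b a = ∑ a ∈ Cs, ∑ b ∈ Cs, r a b := Finset.sum_comm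
  have h3 : ∑ a ∈ Cs, ∑ b ∈ Cs, (t a b + t b a) ≤ ∑ a ∈ Cs, ∑ b ∈ Cs, (r a b + r b a) :=
    Finset.sum_le_sum fun a _ => Finset.sum_le_sum fun b _ => key a b
  simp only [Finset.sum_add_distrib] at h3
  linarith

variable {ι κ : Type*} [Fintype ι] [DecidableEq κ] {c : ι → κ}
  {near : κ → κ → Prop} {n : ℕ}

/-- The number of pairs of points in neighbouring cells of which the first is crowded. -/
theorem sum_near_crowded_le [DecidableRel near] (hsymm : ∀ a b, near a b → near b a)
    (hn : ∀ i, ((Finset.univ.image c).filter fun b => near (c i) b).card ≤ n) :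
    ∑ j, ∑ i, (if near (c i) (c j) ∧ (5 : ℝ) ≤ (Finset.univ.filter fun k => c k = c i).card
      then (1 : ℝ) else 0) ≤
      n * ∑ a ∈ Finset.univ.image c, (if (5 : ℝ) ≤ (Finset.univ.filter fun k => c k = a).card then
        ((Finset.univ.filter fun k => c k = a).card : ℝ) ^ 2 else 0) := by
  set Cs := Finset.univ.image c with hCs
  set m : κ → ℝ := fun a => ((Finset.univ.filter fun k => c k = a).card : ℝ) with hm
  have hcomp : ∀ f : κ → ℝ, ∑ i, f (c i) = ∑ a ∈ Cs, m a * f a := by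
    intro f
    rw [Finset.sum_comp f c]
    simp [hm, hCs]
  have e1 : ∑ j, ∑ i, (if near (c i) (c j) ∧ 5 ≤ m (c i) then (1 : ℝ) else 0) =
      ∑ a ∈ Cs, ∑ b ∈ Cs, (if near a b ∧ 5 ≤ m a then m a * m b else 0) := by
    rw [Finset.sum_comm, hcomp fun a => ∑ j, if near a (c j) ∧ 5 ≤ m a then (1 : ℝ) else 0]
    refine Finset.sum_congr rfl fun a _ => ?_
    rw [hcomp fun b => if near a b ∧ 5 ≤ m a then (1 : ℝ) else 0, Finset.mul_sum]
    refine Finset.sum_congr rfl fun b _ => ?_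
    split_ifs <;> ring
  change ∑ j, ∑ i, (if near (c i) (c j) ∧ 5 ≤ m (c i) then (1 : ℝ) else 0) ≤
    n * ∑ a ∈ Cs, (if 5 ≤ m a then m a ^ 2 else 0)
  rw [e1, Finset.mul_sum]
  refine (sum_crowded_mul_le Cs m (fun _ => Nat.cast_nonneg _) near hsymm).trans
    (Finset.sum_le_sum fun a ha => ?_)
  obtain ⟨i, -, rfl⟩ := Finset.mem_image.1 ha
  by_cases h : 5 ≤ m (c i)
  · simp only [h, and_true, if_true]
    rw [← Finset.sum_filter, Finset.sum_const, nsmul_eq_mul]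
    exact mul_le_mul_of_nonneg_right (by exact_mod_cast hn i) (by positivity)
  · simp [h]

/-- The number of pairs of points in a common cell of which one is in a set that misses at most two
points. -/
theorem sum_same_cell_ge [DecidableEq ι] {T : Finset ι} {p q : ι} (hT : ∀ j, j ∉ T → j = p ∨ j = q) :
    (12 / 25) * ∑ a ∈ Finset.univ.image c,
      (if (5 : ℝ) ≤ (Finset.univ.filter fun k => c k = a).card then
        ((Finset.univ.filter fun k => c k = a).card : ℝ) ^ 2 else 0) ≤
      ∑ j ∈ T, ∑ i ∈ Finset.univ.erase j, (if c i = c j then (1 : ℝ) else 0) := by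
  set m : κ → ℝ := fun a => ((Finset.univ.filter fun k => c k = a).card : ℝ) with hm
  have e1 : ∀ j, ∑ i ∈ Finset.univ.erase j, (if c i = c j then (1 : ℝ) else 0) = m (c j) - 1 := by
    intro j
    have := Finset.add_sum_erase Finset.univ (fun i => if c i = c j then (1 : ℝ) else 0)
      (Finset.mem_univ j)
    have hs : ∑ i, (if c i = c j then (1 : ℝ) else 0) = m (c j) := Finset.sum_boole _ _
    rw [hs, if_pos rfl] at this
    linarith
  simp only [e1]
  rw [← Finset.sum_fiberwise_of_maps_to (s := T) (t := Finset.univ.image c) (g := c)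
    (fun j _ => Finset.mem_image_of_mem c (Finset.mem_univ j)), Finset.mul_sum]
  refine Finset.sum_le_sum fun a ha => ?_
  have hcard : m a ≤ (T.filter fun j => c j = a).card + 2 := by
    have hsub : (Finset.univ.filter fun k => c k = a) ⊆ (T.filter fun j => c j = a) ∪ {p, q} := by
      intro k hk
      by_cases hkT : k ∈ T
      · exact Finset.mem_union_left _ (Finset.mem_filter.2 ⟨hkT, (Finset.mem_filter.1 hk).2⟩)
      · exact Finset.mem_union_right _ (by simpa using hT k hkT)
    have h1 := (Finset.card_le_card hsub).trans (Finset.card_union_le _ _)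
    have h2 : ({p, q} : Finset ι).card ≤ 2 := Finset.card_le_two
    have h3 : (Finset.univ.filter fun k => c k = a).card ≤ (T.filter fun j => c j = a).card + 2 := by
      omega
    simp only [hm]
    exact_mod_cast h3
  have e2 : ∑ j ∈ T with c j = a, (m (c j) - 1) = (T.filter fun j => c j = a).card * (m a - 1) := by
    rw [Finset.sum_congr rfl (g := fun _ => m a - 1) fun j hj => by rw [(Finset.mem_filter.1 hj).2],
      Finset.sum_const, nsmul_eq_mul]
  rw [e2]
  change 12 / 25 * (if 5 ≤ m a then m a ^ 2 else 0) ≤ _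
  have hpos : (1 : ℝ) ≤ m a := by
    obtain ⟨i, -, rfl⟩ := Finset.mem_image.1 ha
    have : 0 < (Finset.univ.filter fun k => c k = c i).card := Finset.card_pos.2 ⟨i, by simp⟩
    simp only [hm]
    exact_mod_cast this
  have h0 : (0 : ℝ) ≤ (T.filter fun j => c j = a).card := Nat.cast_nonneg _
  split_ifs with h5
  -- `(m - 2)(m - 1) ≥ (12/25) m²` for `m ≥ 5`, with equality at `m = 5`; this fixes the constant
  -- `12/25`.
  · nlinarith
  · rw [mul_zero]; exact mul_nonneg h0 (by linarith)

/-- The repulsion within crowded cells outweighs the attraction by them. -/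
theorem cluster_energy_nonneg [DecidableEq ι] {u v : ι → ι → ℝ} {lam Λ : ℝ} (hsymm : ∀ a b, near a b → near b a)
    (hn : ∀ i, (((Finset.univ.image c : Finset κ) : Set κ) ∩ {b | near (c i) b}).ncard ≤ n)
    (hu : ∀ i j, 0 ≤ u i j) (hu' : ∀ i j, c i = c j → lam ≤ u i j) (hv : ∀ i j, v i j ≤ Λ)
    (hv' : ∀ i j, ¬ near (c i) (c j) → v i j = 0) (hΛ : 0 ≤ Λ) (hlam : 8 * n * Λ ≤ lam)
    {T : Finset ι} {p q : ι} (hT : ∀ j, j ∉ T → j = p ∨ j = q) :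
    0 ≤ ∑ j ∈ T, ∑ i ∈ Finset.univ.erase j, (1 / 2 * (u i j - 9 / 8 * v i j) -
      if SparseCell c j i then 9 / 64 * (2 * u i j - 4 * v i j) else 0) := by
  classical
  have hn' : ∀ i, ((Finset.univ.image c).filter fun b => near (c i) b).card ≤ n := by
    intro i
    refine le_trans (le_of_eq ?_) (hn i)
    rw [← Set.ncard_coe_finset]
    congr 1
    ext b
    simp
  set X : ι → ι → ℝ := fun j i =>
    if near (c i) (c j) ∧ (5 : ℝ) ≤ (Finset.univ.filter fun k => c k = c i).card then 1 else 0
    with hX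
  set Y : ι → ι → ℝ := fun j i => if c i = c j then 1 else 0 with hY
  have hX0 : ∀ j i, 0 ≤ X j i := fun j i => by
    change 0 ≤ ite _ _ _
    split_ifs <;> norm_num
  have hlam0 : 0 ≤ lam := le_trans (by positivity) hlam
  -- For sparse `i` the attraction cancels exactly, because `9/64 · 4 = 1/2 · 9/8`, and `1/2 - 9/32
  -- = 7/32` of the repulsion remains. For crowded `i` the attraction is at most `9/16 · Λ`.
  have hterm : ∀ j i, 7 / 32 * lam * Y j i - 9 / 16 * Λ * X j i ≤
      1 / 2 * (u i j - 9 / 8 * v i j) -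
        if SparseCell c j i then 9 / 64 * (2 * u i j - 4 * v i j) else 0 := by
    intro j i
    have hX1' : near (c i) (c j) ∧
        (5 : ℝ) ≤ (Finset.univ.filter fun k => c k = c i).card → X j i = 1 := fun h => if_pos h
    have hYu : lam * Y j i ≤ u i j := by
      change lam * ite _ _ _ ≤ _
      split_ifs with h
      · rw [mul_one]; exact hu' i j h
      · rw [mul_zero]; exact hu i j
    clear_value X Y
    split_ifs with hs
    · linarith [mul_nonneg hΛ (hX0 j i)]
    · have hvX : v i j ≤ Λ * X j i := by
        by_cases hnr : near (c i) (c j)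
        · have h5 : (5 : ℝ) ≤ (Finset.univ.filter fun k => c k = c i).card := by
            have hs' : 4 < (Finset.univ.filter fun k => k ≠ j ∧ c k = c i).card := not_le.1 hs
            have hle := Finset.card_le_card (s := Finset.univ.filter fun k => k ≠ j ∧ c k = c i)
              (t := Finset.univ.filter fun k => c k = c i)
              fun k hk => by simpa using (Finset.mem_filter.1 hk).2.2
            exact_mod_cast (hs'.trans_le hle)
          have hX1 : X j i = 1 := hX1' ⟨hnr, h5⟩
          rw [hX1, mul_one]
          exact hv i j
        · rw [hv' i j hnr]; exact mul_nonneg hΛ (hX0 j i)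
      linarith [hu i j]
  refine le_trans ?_ (Finset.sum_le_sum fun j _ => Finset.sum_le_sum fun i _ => hterm j i)
  simp only [Finset.sum_sub_distrib, ← Finset.mul_sum]
  have hbig : ∑ j ∈ T, ∑ i ∈ Finset.univ.erase j, X j i ≤ ∑ j, ∑ i, X j i :=
    (Finset.sum_le_sum fun j _ => Finset.sum_le_univ_sum_of_nonneg (hX0 j)).trans
      (Finset.sum_le_univ_sum_of_nonneg fun j => Finset.sum_nonneg fun i _ => hX0 j i)
  have h1 := sum_near_crowded_le hsymm hn'
  have h2 := sum_same_cell_ge (c := c) hT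
  set Q := ∑ a ∈ Finset.univ.image c, (if (5 : ℝ) ≤ (Finset.univ.filter fun k => c k = a).card then
        ((Finset.univ.filter fun k => c k = a).card : ℝ) ^ 2 else 0) with hQ
  have hQ0 : 0 ≤ Q := Finset.sum_nonneg fun a _ => by split_ifs <;> positivity
  clear_value Q
  have h3 : 9 / 16 * Λ * ∑ j ∈ T, ∑ i ∈ Finset.univ.erase j, X j i ≤ 9 / 16 * Λ * (n * Q) :=
    mul_le_mul_of_nonneg_left (hbig.trans h1) (by positivity)
  have h4 : 7 / 32 * lam * (12 / 25 * Q) ≤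
      7 / 32 * lam * ∑ j ∈ T, ∑ i ∈ Finset.univ.erase j, Y j i :=
    mul_le_mul_of_nonneg_left h2 (by positivity)
  have h5 : 8 * n * Λ * Q ≤ lam * Q := mul_le_mul_of_nonneg_right hlam hQ0
  have h6 : 0 ≤ n * Λ * Q := mul_nonneg (by positivity) hQ0
  rw [sub_nonneg]
  refine h3.trans (le_trans ?_ h4)
  -- The requirement is `9/16 · n Λ ≤ 7/32 · 12/25 · lam`, that is `lam ≥ (75/14) n Λ`, and `75/14 <
  -- 8`.
  linarith

/-- Among the points other than the `j`-th that lie in sparse cells, at most `4 n` are in a set which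
meets at most `n` cells. -/
theorem card_sparse_le [DecidableEq ι] {j : ι} {A : Set κ} (hA : A.Finite) (hAn : A.ncard ≤ n) (B : Finset ι)
    (hB : ∀ i ∈ B, i ≠ j ∧ SparseCell c j i ∧ c i ∈ A) : B.card ≤ 4 * n := by
  have h1 : B.card ≤ 4 * (B.image c).card := by
    refine Finset.card_le_mul_card_image B 4 fun a ha => ?_
    obtain ⟨i, hi, rfl⟩ := Finset.mem_image.1 ha
    refine le_trans (Finset.card_le_card fun k hk => ?_) (hB i hi).2.1
    obtain ⟨hkB, hk⟩ := Finset.mem_filter.1 hk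
    simp only [Finset.mem_filter, Finset.mem_univ, true_and]
    exact ⟨(hB k hkB).1, hk⟩
  have h2 : (B.image c).card ≤ n := by
    rw [← Set.ncard_coe_finset]
    refine (Set.ncard_le_ncard (fun a ha => ?_) hA).trans hAn
    obtain ⟨i, hi, rfl⟩ := Finset.mem_image.1 (Finset.mem_coe.1 ha)
    exact (hB i hi).2.2
  omega

end Clusters

/-! ### One particle in the field of fixed particles in sparse cells. -/

section Localization

open Filter Topology

/-- Two cells contain points of distance less than `R`. -/
def NearCells {κ : Type*} (cell : R3 → κ) (R : ℝ) (a b : κ) : Prop :=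
  ∃ y z : R3, cell y = a ∧ cell z = b ∧ dist y z < R

/-- `P` and `M` are the repulsive and the attractive part of an even pair interaction of range `R`,
for a partition of space into cells on which the repulsion is bounded below by `lam`, such that at
most `n₁` cells meet a ball of radius `R` and at most `n₂` are near a given one. -/
structure IsCellPotential (P M : R3 → ℝ) (cell : R3 → Fin 3 → ℤ) (R lam Λ : ℝ) (n₁ n₂ : ℕ) :
    Prop where
  measurable_pos : Measurable P
  measurable_neg : Measurable M
  pos_nonneg : ∀ x, 0 ≤ P x
  neg_nonneg : ∀ x, 0 ≤ M x
  pos_bdd : ∃ K, ∀ x, P x ≤ K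
  neg_le : ∀ x, M x ≤ Λ
  neg_eq_zero : ∀ x, R ≤ ‖x‖ → M x = 0
  pos_even : ∀ x, P (-x) = P x
  neg_even : ∀ x, M (-x) = M x
  measurable_cell : Measurable cell
  le_pos : ∀ x y, cell x = cell y → lam ≤ P (x - y)
  card_pos : 0 < n₁
  finite_meeting : ∀ x, {b | ∃ y, cell y = b ∧ dist y x < R}.Finite
  ncard_meeting : ∀ x, {b | ∃ y, cell y = b ∧ dist y x < R}.ncard ≤ n₁
  finite_near : ∀ x, {b | NearCells cell R (cell x) b}.Finite
  ncard_near : ∀ x, {b | NearCells cell R (cell x) b}.ncard ≤ n₂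
  le_lam : 8 * n₂ * Λ ≤ lam
  energy : ∀ φ : R3 → ℂ, ContDiff ℝ 1 φ →
    0 ≤ ∫ x in Metric.ball (0 : R3) R, (gradSq φ x + n₁ * (2 * P x - 4 * M x) * ‖φ x‖ ^ 2)

variable {P M : R3 → ℝ} {cell : R3 → Fin 3 → ℤ} {R lam Λ : ℝ} {n₁ n₂ : ℕ}

namespace IsCellPotential

theorem exists_abs_le (h : IsCellPotential P M cell R lam Λ n₁ n₂) (a b : ℝ) :
    ∃ C, ∀ x, |a * P x - b * M x| ≤ C := by
  obtain ⟨K, hK⟩ := h.pos_bdd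
  refine ⟨|a| * K + |b| * Λ, fun x => (abs_sub _ _).trans (add_le_add ?_ ?_)⟩
  · rw [abs_mul, abs_of_nonneg (h.pos_nonneg x)]; exact mul_le_mul_of_nonneg_left (hK x) (abs_nonneg _)
  · rw [abs_mul, abs_of_nonneg (h.neg_nonneg x)]
    exact mul_le_mul_of_nonneg_left (h.neg_le x) (abs_nonneg _)

/-- The ball is moved to a fixed particle at `z`; evenness of `P` and `M` allows the argument `z -
y` of the pair interaction. -/
theorem energy_translate (h : IsCellPotential P M cell R lam Λ n₁ n₂) {φ : R3 → ℂ}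
    (hφ : ContDiff ℝ 1 φ) (z : R3) :
    0 ≤ ∫ y, (Metric.ball z R).indicator
      (fun y => gradSq φ y + n₁ * (2 * P (z - y) - 4 * M (z - y)) * ‖φ y‖ ^ 2) y := by
  have h1 := h.energy (fun y => φ (z + y)) (hφ.comp (contDiff_const.add contDiff_id))
  rw [← integral_indicator measurableSet_ball] at h1
  rw [← integral_add_left_eq_self _ z]
  refine h1.trans (le_of_eq (integral_congr_ae (Eventually.of_forall fun y => ?_)))
  have hg : gradSq (fun y => φ (z + y)) y = gradSq φ (z + y) := by
    simp only [gradSq, fderiv_comp_add_left]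
  have hz : z - (z + y) = -y := by abel
  by_cases hy : y ∈ Metric.ball (0 : R3) R
  · have hy' : z + y ∈ Metric.ball z R := by simpa using hy
    simp only [Set.indicator_of_mem hy, Set.indicator_of_mem hy', hg, hz, h.pos_even, h.neg_even]
  · have hy' : z + y ∉ Metric.ball z R := by simpa using hy
    simp only [Set.indicator_of_notMem hy, Set.indicator_of_notMem hy']

/-- The kinetic energy of a particle controls its interaction with fixed particles in sparse
cells. -/
theorem one_particle_nonneg (h : IsCellPotential P M cell R lam Λ n₁ n₂) {φ : R3 → ℂ}
    (hφ : ContDiff ℝ 1 φ) (hg : Integrable (gradSq φ)) (hL : Integrable fun y => ‖φ y‖ ^ 2)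
    {ι : Type*} (B : Finset ι) (z : ι → R3)
    (hB : ∀ y, (B.filter fun i => dist (z i) y < R).card ≤ 4 * n₁) :
    0 ≤ ∫ y, (9 / 16 * gradSq φ y +
      ∑ i ∈ B, 9 / 64 * (2 * P (z i - y) - 4 * M (z i - y)) * ‖φ y‖ ^ 2) := by
  obtain ⟨C, hC⟩ := h.exists_abs_le 2 4
  have hn : (0 : ℝ) < n₁ := by exact_mod_cast h.card_pos
  have hm : ∀ i, AEStronglyMeasurable (fun y => 2 * P (z i - y) - 4 * M (z i - y)) volume :=
    fun i => (((h.measurable_pos.comp (measurable_const.sub measurable_id)).const_mul 2).sub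
      ((h.measurable_neg.comp (measurable_const.sub measurable_id)).const_mul 4)).aestronglyMeasurable
  have hi : ∀ i, Integrable fun y => (2 * P (z i - y) - 4 * M (z i - y)) * ‖φ y‖ ^ 2 := fun i =>
    hL.bdd_mul (hm i) (c := C) (Eventually.of_forall fun y => by
      rw [Real.norm_eq_abs]; exact hC _)
  have hi' : ∀ i, Integrable fun y =>
      gradSq φ y + n₁ * (2 * P (z i - y) - 4 * M (z i - y)) * ‖φ y‖ ^ 2 := fun i => by
    have := hg.add ((hi i).const_mul (n₁ : ℝ))
    refine this.congr (Eventually.of_forall fun y => ?_)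
    simp only [Pi.add_apply]; ring
  -- Each ball inequality has weight `9/64 / n₁`. With at most `4 n₁` overlapping balls the gradient
  -- is used with total factor at most `9/16`.
  have hpt : ∀ y, 9 / 64 / n₁ * ∑ i ∈ B, (Metric.ball (z i) R).indicator
      (fun y => gradSq φ y + n₁ * (2 * P (z i - y) - 4 * M (z i - y)) * ‖φ y‖ ^ 2) y ≤
      9 / 16 * gradSq φ y +
        ∑ i ∈ B, 9 / 64 * (2 * P (z i - y) - 4 * M (z i - y)) * ‖φ y‖ ^ 2 := by
    intro y
    have hg0 := gradSq_nonneg φ y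
    have e1 : ∀ i ∈ B, (Metric.ball (z i) R).indicator
        (fun y => gradSq φ y + n₁ * (2 * P (z i - y) - 4 * M (z i - y)) * ‖φ y‖ ^ 2) y ≤
        (if dist (z i) y < R then gradSq φ y else 0) +
          n₁ * ((2 * P (z i - y) - 4 * M (z i - y)) * ‖φ y‖ ^ 2) := by
      intro i _
      by_cases hy : dist (z i) y < R
      · have hy' : y ∈ Metric.ball (z i) R := by rwa [Metric.mem_ball']
        rw [Set.indicator_of_mem hy', if_pos hy]
        exact le_of_eq (by ring)
      · have hy' : y ∉ Metric.ball (z i) R := by rwa [Metric.mem_ball']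
        -- Outside the ball the attraction vanishes, so the interaction left over is nonnegative.
        rw [Set.indicator_of_notMem hy', if_neg hy,
          h.neg_eq_zero _ (by rw [← dist_eq_norm]; exact not_lt.1 hy)]
        have := h.pos_nonneg (z i - y)
        simp only [mul_zero, sub_zero, zero_add]
        positivity
    have e2 : ∑ i ∈ B, (if dist (z i) y < R then gradSq φ y else 0) ≤ 4 * n₁ * gradSq φ y := by
      rw [← Finset.sum_filter, Finset.sum_const, nsmul_eq_mul]
      refine mul_le_mul_of_nonneg_right ?_ hg0
      exact_mod_cast hB y
    have e3 := Finset.sum_le_sum e1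
    rw [Finset.sum_add_distrib, ← Finset.mul_sum] at e3
    calc _ ≤ 9 / 64 / n₁ * (4 * n₁ * gradSq φ y +
          n₁ * ∑ i ∈ B, (2 * P (z i - y) - 4 * M (z i - y)) * ‖φ y‖ ^ 2) :=
          mul_le_mul_of_nonneg_left (e3.trans (add_le_add_left e2 _)) (by positivity)
      _ = _ := by
          have e4 : ∑ i ∈ B, 9 / 64 * (2 * P (z i - y) - 4 * M (z i - y)) * ‖φ y‖ ^ 2 =
              9 / 64 * ∑ i ∈ B, (2 * P (z i - y) - 4 * M (z i - y)) * ‖φ y‖ ^ 2 := by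
            rw [Finset.mul_sum]
            exact Finset.sum_congr rfl fun i _ => mul_assoc _ _ _
          rw [e4]
          generalize ∑ i ∈ B, (2 * P (z i - y) - 4 * M (z i - y)) * ‖φ y‖ ^ 2 = s
          field_simp
          ring
  have hind : ∀ i, Integrable ((Metric.ball (z i) R).indicator
      (fun y => gradSq φ y + n₁ * (2 * P (z i - y) - 4 * M (z i - y)) * ‖φ y‖ ^ 2)) := fun i =>
    (hi' i).indicator measurableSet_ball
  refine le_trans ?_ (integral_mono ((integrable_finsetSum B fun i _ => hind i).const_mul
    (9 / 64 / (n₁ : ℝ))) ((hg.const_mul (9 / 16)).add (integrable_finsetSum B fun i _ =>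
      ((hi i).const_mul (9 / 64)).congr (Eventually.of_forall fun y => (mul_assoc _ _ _).symm))) hpt)
  rw [integral_const_mul, integral_finsetSum B fun i _ => hind i]
  exact mul_nonneg (by positivity) (Finset.sum_nonneg fun i _ => h.energy_translate hφ (z i))

end IsCellPotential

/-- Because the count leaves out the `j`-th point, moving that point changes no sparseness; hence
the set of sparse particles is fixed while `x_j` is integrated. -/
theorem sparseCell_congr {ι κ : Type*} [Fintype ι] [DecidableEq ι] [DecidableEq κ] {c c' : ι → κ}
    {j i : ι} (hij : i ≠ j) (h : ∀ k, k ≠ j → c k = c' k) :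
    SparseCell c j i ↔ SparseCell c' j i := by
  have : (Finset.univ.filter fun k => k ≠ j ∧ c k = c i) =
      Finset.univ.filter fun k => k ≠ j ∧ c' k = c' i := by
    ext k
    simp only [Finset.mem_filter, Finset.mem_univ, true_and]
    refine and_congr_right fun hk => ?_
    rw [h k hk, h i hij]
  rw [SparseCell, SparseCell, this]

/-- This exhibits the insertion as an affine map of `y` whose linear part is the inclusion of the
`j`-th coordinate. -/
theorem insertNth_eq_add_single {n : ℕ} (j : Fin (n + 1)) (y : R3) (x : Fin n → R3) :
    (j.insertNth y x : Config (n + 1)) = j.insertNth 0 x + Pi.single j y := by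
  ext k : 1
  refine Fin.succAboveCases j ?_ (fun i => ?_) k
  · simp
  · simp

/-- The gradient of a function of `N` particles in the coordinates of one of them. -/
theorem gradSq_insertNth {n : ℕ} {F : Config (n + 1) → ℂ} (hF : ContDiff ℝ 1 F) (j : Fin (n + 1))
    (x : Fin n → R3) (y : R3) :
    gradSq (fun y => F (j.insertNth y x)) y = ∑ a, ‖partialDeriv F j a (j.insertNth y x)‖ ^ 2 := by
  have h1 : HasFDerivAt (fun y : R3 => (j.insertNth y x : Config (n + 1)))
      (ContinuousLinearMap.single ℝ (fun _ : Fin (n + 1) => R3) j) y := by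
    rw [funext fun y => insertNth_eq_add_single j y x]
    exact ((ContinuousLinearMap.single ℝ (fun _ : Fin (n + 1) => R3) j).hasFDerivAt).const_add _
  have h2 := ((hF.differentiable one_ne_zero _).hasFDerivAt.comp y h1).fderiv
  simp only [Function.comp_def] at h2
  simp only [gradSq, h2, partialDeriv]
  rfl

theorem contDiff_insertNth {n : ℕ} {F : Config (n + 1) → ℂ} (hF : ContDiff ℝ 1 F) (j : Fin (n + 1))
    (x : Fin n → R3) : ContDiff ℝ 1 (fun y => F (j.insertNth y x)) := by
  rw [funext fun y => congrArg F (insertNth_eq_add_single j y x)]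
  exact hF.comp (contDiff_const.add (ContinuousLinearMap.single ℝ (fun _ : Fin (n + 1) => R3)
    j).contDiff)

end Localization

/-! ### The localized estimate, for `C¹` functions and then in `H¹`. -/

section Core

open Filter Topology

variable {P M : R3 → ℝ} {cell : R3 → Fin 3 → ℤ} {R lam Λ : ℝ} {n₁ n₂ : ℕ}

theorem measurableSet_sparseCell {N : ℕ} (hcell : Measurable cell) (j i : Fin N) :
    MeasurableSet {x : Config N | SparseCell (fun k => cell (x k)) j i} := by
  have hm : Measurable (fun x : Config N => fun k => cell (x k)) :=
    measurable_pi_lambda _ fun k => hcell.comp (measurable_pi_apply k)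
  -- There are countably many assignments of cells to particles, so every set of assignments is
  -- measurable.
  exact hm (Set.to_countable {c : Fin N → Fin 3 → ℤ | SparseCell c j i}).measurableSet

/-- The interaction of the `j`-th with the `i`-th particle, if the latter lies in a sparse cell. -/
def sparseInteraction {N : ℕ} (P M : R3 → ℝ) (cell : R3 → Fin 3 → ℤ) (j i : Fin N)
    (x : Config N) : ℝ :=
  if SparseCell (fun k => cell (x k)) j i then
    9 / 64 * (2 * P (x i - x j) - 4 * M (x i - x j)) else 0

namespace IsCellPotential

theorem measurable_comb {N : ℕ} (h : IsCellPotential P M cell R lam Λ n₁ n₂) (a b : ℝ)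
    (i j : Fin N) : Measurable fun x : Config N => a * P (x i - x j) - b * M (x i - x j) := by
  have hs : Measurable fun x : Config N => x i - x j :=
    (measurable_pi_apply i).sub (measurable_pi_apply j)
  exact ((h.measurable_pos.comp hs).const_mul a).sub ((h.measurable_neg.comp hs).const_mul b)

theorem measurable_sparseInteraction {N : ℕ} (h : IsCellPotential P M cell R lam Λ n₁ n₂)
    (j i : Fin N) : Measurable (sparseInteraction P M cell j i) :=
  Measurable.ite (measurableSet_sparseCell h.measurable_cell j i)
    ((h.measurable_comb 2 4 i j).const_mul (9 / 64)) measurable_const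

theorem exists_sparseInteraction_le {N : ℕ} (h : IsCellPotential P M cell R lam Λ n₁ n₂) :
    ∃ C, ∀ (j i : Fin N) (x : Config N), |sparseInteraction P M cell j i x| ≤ C := by
  obtain ⟨C, hC⟩ := h.exists_abs_le 2 4
  have hC0 : 0 ≤ C := (abs_nonneg _).trans (hC 0)
  refine ⟨9 / 64 * C, fun j i x => ?_⟩
  rw [sparseInteraction]
  split_ifs
  · rw [abs_mul, abs_of_nonneg (by norm_num : (0 : ℝ) ≤ 9 / 64)]
    exact mul_le_mul_of_nonneg_left (hC _) (by norm_num)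
  · simpa using hC0

/-- The kinetic energy of the `j`-th particle controls its interaction with the particles in sparse
cells. -/
theorem kinetic_add_sparse_nonneg {N : ℕ} (h : IsCellPotential P M cell R lam Λ n₁ n₂)
    {F : Config N → ℂ} (hF : ContDiff ℝ 1 F) (hFL : MemLp F 2 volume) {j : Fin N}
    (hFD : ∀ a, MemLp (partialDeriv F j a) 2 volume) {S : Set (Config N)} (hS : MeasurableSet S)
    (hSj : ∀ x y : Config N, (∀ k, k ≠ j → x k = y k) → (x ∈ S ↔ y ∈ S)) :
    0 ≤ ∫ x in S, (9 / 16 * ∑ a, ‖partialDeriv F j a x‖ ^ 2 +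
      ∑ i ∈ Finset.univ.erase j, sparseInteraction P M cell j i x * ‖F x‖ ^ 2) := by
  obtain ⟨n, rfl⟩ : ∃ n, N = n + 1 := ⟨N - 1, by have := j.pos; omega⟩
  have hA : Integrable fun x => ∑ a, ‖partialDeriv F j a x‖ ^ 2 :=
    integrable_finsetSum _ fun a _ => (hFD a).integrable_norm_pow (by norm_num)
  have hB : Integrable fun x => ‖F x‖ ^ 2 := hFL.integrable_norm_pow (by norm_num)
  obtain ⟨C, hC⟩ := h.exists_sparseInteraction_le (N := n + 1)
  have hK : Integrable fun x => 9 / 16 * ∑ a, ‖partialDeriv F j a x‖ ^ 2 +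
      ∑ i ∈ Finset.univ.erase j, sparseInteraction P M cell j i x * ‖F x‖ ^ 2 :=
    (hA.const_mul _).add (integrable_finsetSum _ fun i _ =>
      hB.bdd_mul (h.measurable_sparseInteraction j i).aestronglyMeasurable (c := C)
        (Eventually.of_forall fun x => hC j i x))
  have hKS := hK.indicator hS
  rw [← integral_indicator hS]
  have hmp := (volume_preserving_piFinSuccAbove (fun _ : Fin (n + 1) => R3) j).symm
  have hme := (MeasurableEquiv.piFinSuccAbove (fun _ : Fin (n + 1) => R3) j).symm.measurableEmbedding
  have hsymm : ∀ p : R3 × (Fin n → R3),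
      (MeasurableEquiv.piFinSuccAbove (fun _ : Fin (n + 1) => R3) j).symm p = j.insertNth p.1 p.2 :=
    fun p => rfl
  have hslice : ∀ {f : Config (n + 1) → ℝ}, Integrable f →
      ∀ᵐ x : Fin n → R3, Integrable fun y : R3 => f (j.insertNth y x) := fun {f} hf =>
    ((hmp.integrable_comp_emb hme).2 hf).prod_left_ae
  rw [← hmp.integral_comp hme, Measure.volume_eq_prod, integral_prod_symm]
  swap
  · exact (hmp.integrable_comp_emb hme).2 hKS
  simp only [hsymm]
  refine integral_nonneg_of_ae ?_
  filter_upwards [hslice hA, hslice hB] with x hxA hxB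
  have hagree : ∀ (y y' : R3) (k : Fin (n + 1)), k ≠ j →
      (j.insertNth y x : Config (n + 1)) k = (j.insertNth y' x : Config (n + 1)) k := by
    intro y y' k hk
    obtain ⟨i, rfl⟩ := Fin.exists_succAbove_eq hk
    simp
  -- As `S` does not see the `j`-th particle, the slice over the other positions is all of space or
  -- empty.
  by_cases hx : (j.insertNth 0 x : Config (n + 1)) ∈ S
  swap
  · have hx' : ∀ y, (j.insertNth y x : Config (n + 1)) ∉ S := fun y hy =>
      hx ((hSj _ _ (hagree y 0)).1 hy)
    simp [Set.indicator_of_notMem (hx' _)]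
  have hx' : ∀ y, (j.insertNth y x : Config (n + 1)) ∈ S := fun y =>
    (hSj _ _ (hagree y 0)).2 hx
  set z : Config (n + 1) := j.insertNth 0 x with hz
  set B : Finset (Fin (n + 1)) := (Finset.univ.erase j).filter fun i =>
    SparseCell (fun k => cell (z k)) j i with hBdef
  have hφ := contDiff_insertNth hF j x
  simp only [← gradSq_insertNth hF j x] at hxA
  have hone := h.one_particle_nonneg hφ hxA hxB B z fun y =>
    card_sparse_le (c := fun k => cell (z k)) (h.finite_meeting y) (h.ncard_meeting y) _
      fun i hi => by
        obtain ⟨hi, hd⟩ := Finset.mem_filter.1 hi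
        obtain ⟨hi, hs⟩ := Finset.mem_filter.1 hi
        exact ⟨Finset.ne_of_mem_erase hi, hs, z i, rfl, hd⟩
  refine hone.trans (le_of_eq (integral_congr_ae (Eventually.of_forall fun y => ?_)))
  simp only [Set.indicator_of_mem (hx' y), gradSq_insertNth hF j x]
  congr 1
  rw [hBdef, Finset.sum_filter]
  refine Finset.sum_congr rfl fun i hi => ?_
  have hij := Finset.ne_of_mem_erase hi
  have hiff : SparseCell (fun k => cell ((j.insertNth y x : Config (n + 1)) k)) j i ↔
      SparseCell (fun k => cell (z k)) j i :=
    sparseCell_congr hij fun k hk => congrArg cell (hagree y 0 k hk)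
  have hzi : (j.insertNth y x : Config (n + 1)) i = z i := hagree y 0 i hij
  rw [sparseInteraction]
  simp only [hiff, hzi, Fin.insertNth_apply_same]
  split_ifs <;> simp

/-- The localized energy of a continuously differentiable function is nonnegative. -/
theorem localized_nonneg_of_contDiff {N : ℕ} (h : IsCellPotential P M cell R lam Λ n₁ n₂)
    {F : Config N → ℂ} (hF : ContDiff ℝ 1 F) (hFL : MemLp F 2 volume)
    (hFD : ∀ k a, MemLp (partialDeriv F k a) 2 volume) {S : Fin N → Set (Config N)}
    (hS : ∀ j, MeasurableSet (S j))
    (hSj : ∀ j, ∀ x y : Config N, (∀ k, k ≠ j → x k = y k) → (x ∈ S j ↔ y ∈ S j))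
    (hS2 : ∀ x, (∀ j, x ∉ S j) ∨ ∃ p q, ∀ j, x ∉ S j → j = p ∨ j = q) :
    0 ≤ 7 / 8 * kineticForm S (partialDeriv F) +
      localizedPairForm S (fun x => P x - 9 / 8 * M x) F := by
  classical
  have hB : Integrable fun x => ‖F x‖ ^ 2 := hFL.integrable_norm_pow (by norm_num)
  have hA : ∀ j, Integrable fun x => ∑ a, ‖partialDeriv F j a x‖ ^ 2 := fun j =>
    integrable_finsetSum _ fun a _ => (hFD j a).integrable_norm_pow (by norm_num)
  obtain ⟨C, hC⟩ := h.exists_sparseInteraction_le (N := N)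
  obtain ⟨C', hC'⟩ := h.exists_abs_le (1 / 2) (9 / 16)
  have hs : ∀ j i, Integrable fun x => sparseInteraction P M cell j i x * ‖F x‖ ^ 2 := fun j i =>
    hB.bdd_mul (h.measurable_sparseInteraction j i).aestronglyMeasurable (c := C)
      (Eventually.of_forall fun x => hC j i x)
  have hw : ∀ i j : Fin N, Integrable fun x : Config N =>
      1 / 2 * (P (x i - x j) - 9 / 8 * M (x i - x j)) * ‖F x‖ ^ 2 := fun i j => by
    refine (hB.bdd_mul (h.measurable_comb (1 / 2) (9 / 16) i j).aestronglyMeasurable (c := C')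
      (Eventually.of_forall fun x => hC' _)).congr (Eventually.of_forall fun x => ?_)
    simp only; ring
  have hkin : ∀ j, -(∑ i ∈ Finset.univ.erase j,
      ∫ x in S j, sparseInteraction P M cell j i x * ‖F x‖ ^ 2) ≤
      7 / 8 * ∫ x in S j, ∑ a, ‖partialDeriv F j a x‖ ^ 2 := by
    intro j
    -- The one-particle bound spends `9/16` of the kinetic energy, which is within the available
    -- `7/8`.
    have h1 := h.kinetic_add_sparse_nonneg hF hFL (hFD j) (hS j) (hSj j)
    rw [integral_add ((hA j).integrableOn.const_mul _)
      (integrable_finsetSum _ fun i _ => (hs j i).integrableOn), integral_const_mul,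
      integral_finsetSum _ fun i _ => (hs j i).integrableOn] at h1
    have h2 : 0 ≤ ∫ x in S j, ∑ a, ‖partialDeriv F j a x‖ ^ 2 :=
      integral_nonneg fun x => Finset.sum_nonneg fun a _ => by positivity
    linarith
  have hpot : ∑ j, ∑ i ∈ Finset.univ.erase j, ∫ x in S j,
      sparseInteraction P M cell j i x * ‖F x‖ ^ 2 ≤
      localizedPairForm S (fun x => P x - 9 / 8 * M x) F := by
    rw [localizedPairForm, ← sub_nonneg, ← Finset.sum_sub_distrib]
    simp only [← Finset.sum_sub_distrib]
    have e1 : ∀ j i, (∫ x in S j, 1 / 2 * (P (x i - x j) - 9 / 8 * M (x i - x j)) * ‖F x‖ ^ 2) -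
        (∫ x in S j, sparseInteraction P M cell j i x * ‖F x‖ ^ 2) =
        ∫ x, (S j).indicator (fun x => (1 / 2 * (P (x i - x j) - 9 / 8 * M (x i - x j)) -
          sparseInteraction P M cell j i x) * ‖F x‖ ^ 2) x := by
      intro j i
      rw [integral_indicator (hS j), ← integral_sub (hw i j).integrableOn (hs j i).integrableOn]
      simp only [sub_mul]
    have e2 : ∀ j i, Integrable ((S j).indicator (fun x =>
        (1 / 2 * (P (x i - x j) - 9 / 8 * M (x i - x j)) -
          sparseInteraction P M cell j i x) * ‖F x‖ ^ 2)) := by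
      intro j i
      refine Integrable.indicator ?_ (hS j)
      simp only [sub_mul]
      exact (hw i j).sub (hs j i)
    simp only [e1]
    simp only [← integral_finsetSum _ fun i _ => e2 _ i]
    rw [← integral_finsetSum _ fun j _ => integrable_finsetSum _ fun i _ => e2 j i]
    refine integral_nonneg fun x => ?_
    simp only [Pi.zero_apply]
    -- The integrand is treated pointwise: the sum runs over the `j` with `x ∈ S j`, which is either
    -- empty or misses at most `p` and `q`.
    rcases hS2 x with hx | ⟨p, q, hpq⟩
    · refine le_of_eq (Eq.symm ?_)
      exact Finset.sum_eq_zero fun j _ => Finset.sum_eq_zero fun i _ =>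
        Set.indicator_of_notMem (hx j) _
    · have e3 : ∀ j, ∑ i ∈ Finset.univ.erase j, (S j).indicator (fun x =>
          (1 / 2 * (P (x i - x j) - 9 / 8 * M (x i - x j)) -
            sparseInteraction P M cell j i x) * ‖F x‖ ^ 2) x =
          if x ∈ S j then (∑ i ∈ Finset.univ.erase j,
            (1 / 2 * (P (x i - x j) - 9 / 8 * M (x i - x j)) -
            sparseInteraction P M cell j i x)) * ‖F x‖ ^ 2 else 0 := by
        intro j
        simp only [Set.indicator_apply, Finset.sum_mul]
        split_ifs <;> simp
      simp only [e3]
      rw [← Finset.sum_filter, ← Finset.sum_mul]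
      refine mul_nonneg ?_ (by positivity)
      refine cluster_energy_nonneg (c := fun k => cell (x k)) (near := NearCells cell R)
        (u := fun i j => P (x i - x j)) (v := fun i j => M (x i - x j)) (lam := lam) (Λ := Λ)
        (n := n₂) ?_ ?_ (fun i j => h.pos_nonneg _) (fun i j hij => h.le_pos _ _ hij)
        (fun i j => h.neg_le _) ?_ ((h.neg_nonneg 0).trans (h.neg_le 0)) h.le_lam (p := p) (q := q) ?_
      · rintro a b ⟨y, z, hy, hz, hd⟩
        exact ⟨z, y, hz, hy, by rwa [dist_comm]⟩
      · intro i
        exact (Set.ncard_le_ncard Set.inter_subset_right (h.finite_near (x i))).trans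
          (h.ncard_near (x i))
      · intro i j hij
        refine h.neg_eq_zero _ (not_lt.1 fun hlt => hij ⟨x i, x j, rfl, rfl, ?_⟩)
        rwa [dist_eq_norm]
      · intro j hj
        exact hpq j (by simpa using hj)
  have hsum := Finset.sum_le_sum fun j (_ : j ∈ Finset.univ) => hkin j
  rw [Finset.sum_neg_distrib, ← Finset.mul_sum] at hsum
  rw [kineticForm]
  linarith

end IsCellPotential

/-- Quadratic forms in the gradient and in the function itself pass to the limit. -/
theorem tendsto_kineticForm {N : ℕ} (S : Fin N → Set (Config N))
    {D : Fin N → Fin 3 → Config N → ℂ} {E : ℕ → Fin N → Fin 3 → Config N → ℂ}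
    (hD : ∀ k a, MemLp (D k a) 2 volume) (hE : ∀ n k a, MemLp (E n k a) 2 volume)
    (h : ∀ k a, Tendsto (fun n => eLpNorm (E n k a - D k a) 2 volume) atTop (𝓝 0)) :
    Tendsto (fun n => kineticForm S (E n)) atTop (𝓝 (kineticForm S D)) := by
  refine tendsto_finsetSum _ fun k _ => ?_
  have e : ∀ G : Fin N → Fin 3 → Config N → ℂ, (∀ k a, MemLp (G k a) 2 volume) →
      ∫ x in S k, ∑ a, ‖G k a x‖ ^ 2 = ∑ a, ∫ x in S k, 1 * ‖G k a x‖ ^ 2 := by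
    intro G hG
    rw [integral_finsetSum _ fun a _ => ((hG k a).integrable_norm_pow (by norm_num)).integrableOn]
    simp only [one_mul]
  simp only [e D hD, e _ (hE _)]
  refine tendsto_finsetSum _ fun a _ => ?_
  refine tendsto_integral_mul_norm_sq (C := 1) aestronglyMeasurable_const
    (Eventually.of_forall fun _ => by norm_num) ((hD k a).restrict _) (fun n => (hE n k a).restrict _) ?_
  exact tendsto_of_tendsto_of_tendsto_of_le_of_le tendsto_const_nhds (h k a) (fun _ => zero_le)
    fun n => eLpNorm_restrict_le _ _ _ _

theorem tendsto_localizedPairForm {N : ℕ} (S : Fin N → Set (Config N)) {U : R3 → ℝ}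
    (hU : Measurable U) {C : ℝ} (hC : ∀ x, |U x| ≤ C) {Ψ : Config N → ℂ} {F : ℕ → Config N → ℂ}
    (hΨ : MemLp Ψ 2 volume) (hF : ∀ n, MemLp (F n) 2 volume)
    (h : Tendsto (fun n => eLpNorm (F n - Ψ) 2 volume) atTop (𝓝 0)) :
    Tendsto (fun n => localizedPairForm S U (F n)) atTop (𝓝 (localizedPairForm S U Ψ)) := by
  refine tendsto_finsetSum _ fun j _ => tendsto_finsetSum _ fun i _ => ?_
  refine tendsto_integral_mul_norm_sq (w := fun x : Config N => 1 / 2 * U (x i - x j)) (C := 1 / 2 * C)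
    ?_ (Eventually.of_forall fun x => ?_) (hΨ.restrict _) (fun n => (hF n).restrict _) ?_
  · exact ((hU.comp ((measurable_pi_apply i).sub
      (measurable_pi_apply j))).const_mul (1 / 2)).aestronglyMeasurable
  · rw [abs_mul, abs_of_nonneg (by norm_num : (0 : ℝ) ≤ 1 / 2)]
    exact mul_le_mul_of_nonneg_left (hC _) (by norm_num)
  · exact tendsto_of_tendsto_of_tendsto_of_le_of_le tendsto_const_nhds h (fun _ => zero_le)
      fun n => eLpNorm_restrict_le _ _ _ _

/-- The localized Hamiltonian of a cell potential is nonnegative. -/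
theorem IsCellPotential.localizedHamiltonianNonneg {N : ℕ}
    (h : IsCellPotential P M cell R lam Λ n₁ n₂) {S : Fin N → Set (Config N)}
    (hS : ∀ j, MeasurableSet (S j))
    (hSj : ∀ j, ∀ x y : Config N, (∀ k, k ≠ j → x k = y k) → (x ∈ S j ↔ y ∈ S j))
    (hS2 : ∀ x, (∀ j, x ∉ S j) ∨ ∃ p q, ∀ j, x ∉ S j → j = p ∨ j = q) :
    LocalizedHamiltonianNonneg N S (7 / 8) (fun x => P x - 9 / 8 * M x) := by
  intro Ψ D hΨ
  obtain ⟨F, hF, hFL, hFD, hFΨ, hFDD⟩ := hΨ.exists_approx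
  obtain ⟨C, hC⟩ := h.exists_abs_le 1 (9 / 8)
  have t1 := tendsto_kineticForm S hΨ.memLp_grad hFD hFDD
  have t2 := tendsto_localizedPairForm S (U := fun x => P x - 9 / 8 * M x)
    (h.measurable_pos.sub (h.measurable_neg.const_mul _)) (C := C)
    (fun x => by simpa using hC x) hΨ.memLp hFL hFΨ
  exact ge_of_tendsto' ((t1.const_mul (7 / 8)).add t2) fun n =>
    h.localized_nonneg_of_contDiff (hF n) (hFL n) (hFD n) hS hSj hS2

end Core

/-! ### Invariance of cell potentials under scaling. -/

section Scaling

open Filter Topology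

variable {P M : R3 → ℝ} {cell : R3 → Fin 3 → ℤ} {R lam Λ : ℝ} {n₁ n₂ : ℕ}

theorem gradSq_comp_smul (φ : R3 → ℂ) (c : ℝ) (x : R3) :
    gradSq (fun y => φ (c • y)) x = c ^ 2 * gradSq φ (c • x) := by
  have : fderiv ℝ (fun y => φ (c • y)) x = c • fderiv ℝ φ (c • x) := fderiv_comp_smul c
  simp only [gradSq, this, smul_apply, norm_smul, mul_pow, Finset.mul_sum, Real.norm_eq_abs, sq_abs]

/-- The scaling `x ↦ s² V(s x)` of a cell potential. -/
theorem IsCellPotential.scale (h : IsCellPotential P M cell R lam Λ n₁ n₂) {s : ℝ} (hs : 0 < s) :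
    IsCellPotential (fun x => s ^ 2 * P (s • x)) (fun x => s ^ 2 * M (s • x))
      (fun x => cell (s • x)) (R / s) (s ^ 2 * lam) (s ^ 2 * Λ) n₁ n₂ := by
  have hms : Measurable fun x : R3 => s • x := measurable_const_smul s
  have hdist : ∀ y z : R3, dist y z < R / s → dist (s • y) (s • z) < R := by
    intro y z hd
    rw [dist_smul₀, Real.norm_of_nonneg hs.le]
    rwa [lt_div_iff₀' hs] at hd
  have sub1 : ∀ x, {b | ∃ y, cell (s • y) = b ∧ dist y x < R / s} ⊆
      {b | ∃ y, cell y = b ∧ dist y (s • x) < R} := by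
    rintro x b ⟨y, hy, hd⟩
    exact ⟨s • y, hy, hdist _ _ hd⟩
  have sub2 : ∀ x, {b | NearCells (fun x => cell (s • x)) (R / s) (cell (s • x)) b} ⊆
      {b | NearCells cell R (cell (s • x)) b} := by
    rintro x b ⟨y, z, hy, hz, hd⟩
    exact ⟨s • y, s • z, hy, hz, hdist _ _ hd⟩
  exact {
    measurable_pos := (h.measurable_pos.comp hms).const_mul _
    measurable_neg := (h.measurable_neg.comp hms).const_mul _
    pos_nonneg := fun x => mul_nonneg (by positivity) (h.pos_nonneg _)
    neg_nonneg := fun x => mul_nonneg (by positivity) (h.neg_nonneg _)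
    pos_bdd := by
      obtain ⟨K, hK⟩ := h.pos_bdd
      exact ⟨s ^ 2 * K, fun x => mul_le_mul_of_nonneg_left (hK _) (by positivity)⟩
    neg_le := fun x => mul_le_mul_of_nonneg_left (h.neg_le _) (by positivity)
    neg_eq_zero := fun x hx => by
      rw [h.neg_eq_zero, mul_zero]
      rw [norm_smul, Real.norm_of_nonneg hs.le]
      rwa [div_le_iff₀' hs] at hx
    pos_even := fun x => by rw [smul_neg, h.pos_even]
    neg_even := fun x => by rw [smul_neg, h.neg_even]
    measurable_cell := h.measurable_cell.comp hms
    le_pos := fun x y hxy => by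
      rw [smul_sub]
      exact mul_le_mul_of_nonneg_left (h.le_pos _ _ hxy) (by positivity)
    card_pos := h.card_pos
    finite_meeting := fun x => (h.finite_meeting _).subset (sub1 x)
    ncard_meeting := fun x =>
      (Set.ncard_le_ncard (sub1 x) (h.finite_meeting _)).trans (h.ncard_meeting _)
    finite_near := fun x => (h.finite_near _).subset (sub2 x)
    ncard_near := fun x => (Set.ncard_le_ncard (sub2 x) (h.finite_near _)).trans (h.ncard_near _)
    le_lam := by
      have := mul_le_mul_of_nonneg_left h.le_lam (sq_nonneg s)
      linarith
    energy := fun φ hφ => by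
      have h1 := h.energy (fun y => φ (s⁻¹ • y)) (hφ.comp (contDiff_const_smul s⁻¹))
      rw [← integral_indicator measurableSet_ball] at h1 ⊢
      -- For the test function `φ (s⁻¹ • y)` the squared gradient at `s • x` acquires the factor
      -- `s⁻²`. Multiplying the integrand by `s²` therefore restores the kinetic term and scales the
      -- potential as required.
      have h2 : ∀ x : R3, (Metric.ball (0 : R3) (R / s)).indicator (fun x => gradSq φ x +
          n₁ * (2 * (s ^ 2 * P (s • x)) - 4 * (s ^ 2 * M (s • x))) * ‖φ x‖ ^ 2) x =
          s ^ 2 * (Metric.ball (0 : R3) R).indicator (fun y => gradSq (fun y => φ (s⁻¹ • y)) y +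
          n₁ * (2 * P y - 4 * M y) * ‖φ (s⁻¹ • y)‖ ^ 2) (s • x) := by
        intro x
        have hmem : s • x ∈ Metric.ball (0 : R3) R ↔ x ∈ Metric.ball (0 : R3) (R / s) := by
          rw [mem_ball_zero_iff, mem_ball_zero_iff, norm_smul, Real.norm_of_nonneg hs.le,
            lt_div_iff₀' hs]
        have hx : s⁻¹ • s • x = x := by rw [smul_smul, inv_mul_cancel₀ hs.ne', one_smul]
        by_cases hb : x ∈ Metric.ball (0 : R3) (R / s)
        · rw [Set.indicator_of_mem hb, Set.indicator_of_mem (hmem.2 hb)]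
          simp only [gradSq_comp_smul, hx]
          field_simp
        · rw [Set.indicator_of_notMem hb, Set.indicator_of_notMem (mt hmem.1 hb), mul_zero]
      simp only [h2, integral_const_mul]
      rw [Measure.integral_comp_smul]
      exact mul_nonneg (by positivity) (mul_nonneg (abs_nonneg _) h1) }

end Scaling

/-! ### The partition into cubes. -/

section Cubes

/-- The index of the cube of side `s` that contains `x`. -/
def cubeIndex (s : ℝ) (x : R3) : Fin 3 → ℤ := fun a => ⌊x a / s⌋

theorem mem_gridCube_cubeIndex {s : ℝ} (hs : 0 < s) (x : R3) : x ∈ gridCube s (cubeIndex s x) :=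
  fun _ => ⟨(le_div_iff₀ hs).1 (Int.floor_le _), (div_lt_iff₀ hs).1 (Int.lt_floor_add_one _)⟩

theorem measurable_cubeIndex (s : ℝ) : Measurable (cubeIndex s) := by
  refine measurable_pi_lambda _ fun a => Int.measurable_floor.comp ?_
  have : Continuous fun x : R3 => x a / s := by fun_prop
  exact this.measurable

/-- A cube of side `r / √3` has diagonal `r`; the strict inequality comes from the cubes being
half-open. -/
theorem norm_sub_lt_of_cubeIndex_eq {r : ℝ} (hr : 0 < r) {x y : R3}
    (h : cubeIndex (r / √3) x = cubeIndex (r / √3) y) : ‖x - y‖ < r := by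
  have hs : 0 < r / √3 := by positivity
  have hc : ∀ a, |x a - y a| < r / √3 := by
    intro a
    have hx := mem_gridCube_cubeIndex hs x a
    have hy := mem_gridCube_cubeIndex hs y a
    rw [h] at hx
    rw [abs_lt]
    constructor <;> nlinarith [hx.1, hx.2, hy.1, hy.2]
  have hsq : ‖x - y‖ ^ 2 < r ^ 2 := by
    rw [EuclideanSpace.norm_sq_eq, Fin.sum_univ_three]
    have h3 : (r / √3) ^ 2 = r ^ 2 / 3 := by rw [div_pow, Real.sq_sqrt (by norm_num)]
    have hq : ∀ a, ‖(x - y) a‖ ^ 2 < r ^ 2 / 3 := by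
      intro a
      rw [← h3]
      have : ‖(x - y) a‖ = |x a - y a| := by simp [Real.norm_eq_abs]
      rw [this]
      exact pow_lt_pow_left₀ (hc a) (abs_nonneg _) two_ne_zero
    linarith [hq 0, hq 1, hq 2]
  exact lt_of_pow_lt_pow_left₀ 2 hr.le hsq

theorem finite_cubesMeeting {b₁ : ℝ} (b₂ : ℝ) (h₁ : 0 < b₁) (x : R3) :
    (cubesMeeting b₁ b₂ x).Finite :=
  (Finset.finite_toSet _).subset (cubesMeeting_subset b₁ b₂ h₁ x)

theorem ncard_cubesMeeting_le {b₁ : ℝ} (b₂ : ℝ) (h₁ : 0 < b₁) (x : R3) :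
    (cubesMeeting b₁ b₂ x).ncard ≤ cubeCount b₁ b₂ :=
  le_ciSup (bddAbove_ncard_cubesMeeting b₁ b₂ h₁) x

theorem cubeCount_pos {b₁ b₂ : ℝ} (h₁ : 0 < b₁) (h₂ : 0 < b₂) : 0 < cubeCount b₁ b₂ := by
  refine lt_of_lt_of_le ?_ (ncard_cubesMeeting_le b₂ h₁ 0)
  rw [Set.ncard_pos (finite_cubesMeeting b₂ h₁ 0)]
  exact ⟨cubeIndex (b₁ / √3) 0, 0, mem_gridCube_cubeIndex (by positivity) 0, by simpa using h₂⟩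

end Cubes

/-! ### From the assumption on `V` to a cell potential. -/

section Potential

open Filter Topology

variable {V : R3 → ℝ} {r₁ r₂ R lam : ℝ}

namespace PotentialAssumption

theorem ae_abs_le (hV : PotentialAssumption V r₁ r₂ R lam) :
    ∀ᵐ x, |V x| ≤ (eLpNorm V ∞ volume).toReal := by
  filter_upwards [enorm_ae_le_eLpNormEssSup V volume] with x hx
  rw [← eLpNorm_exponent_top] at hx
  have := ENNReal.toReal_mono hV.memLp_top.2.ne hx
  simpa using this

theorem memLp_neg (hV : PotentialAssumption V r₁ r₂ R lam) :
    MemLp (fun x => (V x)⁻) ∞ volume := by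
  refine hV.memLp_top.mono ?_ (Eventually.of_forall fun x => ?_)
  · exact (continuous_negPart (α := ℝ)).comp_aestronglyMeasurable hV.memLp_top.1
  · rw [Real.norm_of_nonneg (negPart_nonneg _), Real.norm_eq_abs, ← posPart_add_negPart]
    linarith [posPart_nonneg (V x)]

theorem ae_neg_le (hV : PotentialAssumption V r₁ r₂ R lam) :
    ∀ᵐ x, (V x)⁻ ≤ (eLpNorm (fun x => (V x)⁻) ∞ volume).toReal := by
  filter_upwards [enorm_ae_le_eLpNormEssSup (fun x => (V x)⁻) volume] with x hx
  rw [← eLpNorm_exponent_top] at hx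
  have := ENNReal.toReal_mono hV.memLp_neg.2.ne hx
  simpa [abs_of_nonneg (negPart_nonneg (V x))] using this

theorem neg_eq_zero (hV : PotentialAssumption V r₁ r₂ R lam) {x : R3} (hx : R < ‖x‖) :
    (V x)⁻ = 0 := by
  by_contra h
  have : x ∈ tsupport (fun x => (V x)⁻) := subset_tsupport _ h
  rw [hV.support_neg] at this
  exact absurd (mem_closedBall_zero_iff.1 this.1) (not_le.2 hx)

/-- `V⁺` is positive on the ball of radius `r₁`, which must therefore lie in its support. The
consequence `r₁ < R` bounds the reach of neighbouring cubes. -/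
theorem r₁_le (hV : PotentialAssumption V r₁ r₂ R lam) : r₁ ≤ r₂ := by
  by_contra! h
  obtain ⟨t, ht1, ht2⟩ := exists_between h
  set x : R3 := EuclideanSpace.single 0 t with hx
  have ht0 : 0 < t := hV.r₂_pos.trans ht1
  have hn : ‖x‖ = t := by simp [hx, abs_of_pos ht0]
  have h1 := hV.core x (by rw [mem_ball_zero_iff, hn]; exact ht2)
  have h2 : x ∈ tsupport (fun x => (V x)⁺) :=
    subset_tsupport _ (hV.lam_pos.trans_le h1).ne'
  rw [hV.support_pos, mem_closedBall_zero_iff, hn] at h2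
  linarith

/-- The energy condition for arbitrary functions. -/
theorem energy (hV : PotentialAssumption V r₁ r₂ R lam) {φ : R3 → ℂ} (hφ : ContDiff ℝ 1 φ) :
    0 ≤ ∫ x in Metric.ball (0 : R3) R,
      (gradSq φ x + cubeCount r₁ R * (2 * (V x)⁺ - 4 * (V x)⁻) * ‖φ x‖ ^ 2) := by
  obtain ⟨ε, hε0, hε1, H⟩ := hV.energy_nonneg
  have hε : 0 < 1 - ε := by linarith
  have hVm := hV.memLp_top.1
  set X : R3 → ℝ := fun x => cubeCount r₁ R * (2 * (V x)⁺ - 4 * (V x)⁻) with hX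
  have hXm : AEStronglyMeasurable X volume :=
    ((((continuous_posPart (α := ℝ)).comp_aestronglyMeasurable hVm).const_mul 2).sub
      (((continuous_negPart (α := ℝ)).comp_aestronglyMeasurable hVm).const_mul 4)).const_mul _
  set C : ℝ := cubeCount r₁ R * (4 * (eLpNorm V ∞ volume).toReal) with hC
  have hXb : ∀ᵐ x, |X x| ≤ C := by
    filter_upwards [hV.ae_abs_le] with x hx
    rw [hX, hC, abs_mul, abs_of_nonneg (Nat.cast_nonneg (α := ℝ) (cubeCount r₁ R))]
    refine mul_le_mul_of_nonneg_left (le_trans ?_ (mul_le_mul_of_nonneg_left hx (by norm_num)))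
      (Nat.cast_nonneg _)
    rw [← posPart_add_negPart (V x), abs_le]
    constructor <;> linarith [posPart_nonneg (V x), negPart_nonneg (V x)]
  have h1 := _root_.energy_nonneg (W := fun x => 1 / (1 - ε) * X x) (R := R) (C := 1 / (1 - ε) * C)
    (hXm.const_mul _) (by
      filter_upwards [hXb] with x hx
      rw [abs_mul, abs_of_nonneg (a := 1 / (1 - ε)) (by positivity)]
      exact mul_le_mul_of_nonneg_left hx (by positivity))
    (fun x y hxy => by simp only [hX, hV.radial x y hxy]) (fun ψ hψ hψ1 => by
      have := H ψ hψ hψ1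
      rw [ballEnergy] at this
      simpa only [hX, mul_assoc] using this) hφ
  have i1 : IntegrableOn (gradSq φ) (Metric.ball 0 R) volume :=
    ((continuous_gradSq hφ).continuousOn.integrableOn_compact
      (isCompact_closedBall (0 : R3) R)).mono_set Metric.ball_subset_closedBall
  have i2 : IntegrableOn (fun x : R3 => X x * ‖φ x‖ ^ 2) (Metric.ball 0 R) volume := by
    have : IntegrableOn (fun x : R3 => ‖φ x‖ ^ 2) (Metric.ball 0 R) volume :=
      ((hφ.continuous.norm.pow 2).continuousOn.integrableOn_compact
        (isCompact_closedBall (0 : R3) R)).mono_set Metric.ball_subset_closedBall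
    exact Integrable.bdd_mul (c := C) this hXm.restrict
      (by simpa [Real.norm_eq_abs] using ae_restrict_of_ae hXb)
  simp only [mul_assoc (1 / (1 - ε))] at h1
  rw [integral_add i1 (i2.const_mul _), integral_const_mul] at h1
  rw [integral_add i1 i2]
  have h2 : 0 ≤ ∫ x in Metric.ball (0 : R3) R, gradSq φ x := integral_nonneg fun x => gradSq_nonneg φ x
  -- Multiplying by `1 - ε` moves the factor to the kinetic term, where it can only be increased to
  -- `1`.
  have h3 := mul_nonneg hε.le h1
  rw [mul_add, ← mul_assoc, mul_one_div_cancel hε.ne', one_mul] at h3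
  nlinarith

/-- The interaction agrees almost everywhere with a cell potential. -/
theorem exists_isCellPotential (hV : PotentialAssumption V r₁ r₂ R lam) :
    ∃ P M : R3 → ℝ, (∀ᵐ x, P x = (V x)⁺) ∧ (∀ᵐ x, M x = (V x)⁻) ∧
      IsCellPotential P M (cubeIndex (r₁ / √3)) R lam
        (eLpNorm (fun x => (V x)⁻) ∞ volume).toReal (cubeCount r₁ R) (cubeCount r₁ (3 * R)) := by
  have hs : 0 < r₁ / √3 := div_pos hV.r₁_pos (by positivity)
  have hR : 0 < R := hV.r₂_pos.trans hV.r₂_lt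
  have hr : r₁ < R := hV.r₁_le.trans_lt hV.r₂_lt
  set Λ := (eLpNorm (fun x => (V x)⁻) ∞ volume).toReal with hΛ
  set K := (eLpNorm V ∞ volume).toReal with hK
  have hΛ0 : 0 ≤ Λ := ENNReal.toReal_nonneg
  have hK0 : 0 ≤ K := ENNReal.toReal_nonneg
  obtain ⟨V', hV'm, hVV'⟩ := hV.memLp_top.1
  have hV'm := hV'm.measurable
  -- The bounds on `V` that come from essential suprema hold only almost everywhere. Truncating at
  -- them, raising to `lam` on the core and cutting off outside the open ball makes them hold
  -- everywhere.
  set P₀ : R3 → ℝ := fun x => max (min (V' x)⁺ K) ((Metric.ball (0 : R3) r₁).indicator (fun _ => lam) x)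
    with hP₀
  set M₀ : R3 → ℝ := (Metric.ball (0 : R3) R).indicator (fun x => min (V' x)⁻ Λ) with hM₀
  have hP₀m : Measurable P₀ := (((continuous_posPart (α := ℝ)).measurable.comp hV'm).min
    measurable_const).max (measurable_const.indicator measurableSet_ball)
  have hM₀m : Measurable M₀ := (((continuous_negPart (α := ℝ)).measurable.comp hV'm).min
    measurable_const).indicator measurableSet_ball
  have hP₀V : ∀ᵐ x, P₀ x = (V x)⁺ := by
    filter_upwards [hVV', hV.ae_abs_le] with x hx hxK
    have h1 : (V x)⁺ ≤ K := by
      rw [← posPart_add_negPart] at hxK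
      linarith [negPart_nonneg (V x)]
    simp only [hP₀, ← hx, min_eq_left h1]
    refine max_eq_left ?_
    by_cases hb : x ∈ Metric.ball (0 : R3) r₁
    · rw [Set.indicator_of_mem hb]; exact hV.core x hb
    · rw [Set.indicator_of_notMem hb]; exact posPart_nonneg _
  have hM₀V : ∀ᵐ x, M₀ x = (V x)⁻ := by
    have hsph : ∀ᵐ x : R3, x ∉ Metric.sphere (0 : R3) R :=
      measure_eq_zero_iff_ae_notMem.1 (Measure.addHaar_sphere volume 0 R)
    filter_upwards [hVV', hV.ae_neg_le, hsph] with x hx hxΛ hxs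
    by_cases hb : x ∈ Metric.ball (0 : R3) R
    · simp only [hM₀, Set.indicator_of_mem hb, ← hx]
      exact min_eq_left hxΛ
    · rw [hM₀, Set.indicator_of_notMem hb, hV.neg_eq_zero]
      rw [mem_ball_zero_iff, not_lt] at hb
      rw [mem_sphere_zero_iff_norm] at hxs
      exact lt_of_le_of_ne hb (Ne.symm hxs)
  have hneg : ∀ {p : R3 → Prop}, (∀ᵐ x, p x) → ∀ᵐ x, p (-x) := fun hp =>
    (Measure.measurePreserving_neg (volume : Measure R3)).quasiMeasurePreserving.ae hp
  have hVneg : ∀ x, V (-x) = V x := fun x => hV.radial _ _ (norm_neg x)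
  -- The measurable representative of `V` need not be even; the maximum with the reflected function
  -- is.
  have hPV : ∀ᵐ x, max (P₀ x) (P₀ (-x)) = (V x)⁺ := by
    filter_upwards [hP₀V, hneg hP₀V] with x h1 h2
    rw [h1, h2, hVneg, max_self]
  have hMV : ∀ᵐ x, max (M₀ x) (M₀ (-x)) = (V x)⁻ := by
    filter_upwards [hM₀V, hneg hM₀V] with x h1 h2
    rw [h1, h2, hVneg, max_self]
  have hP₀0 : ∀ x, 0 ≤ P₀ x := fun x => le_max_of_le_left (le_min (posPart_nonneg _) hK0)
  have hM₀0 : ∀ x, 0 ≤ M₀ x := fun x =>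
    Set.indicator_nonneg (fun x _ => le_min (negPart_nonneg _) hΛ0) x
  have hM₀Λ : ∀ x, M₀ x ≤ Λ := fun x =>
    Set.indicator_le' (fun x _ => min_le_right _ _) (fun x _ => hΛ0) x
  have hM₀R : ∀ x, R ≤ ‖x‖ → M₀ x = 0 := fun x hx =>
    Set.indicator_of_notMem (by rw [mem_ball_zero_iff]; exact not_lt.2 hx) _
  have hP₀K : ∀ x, P₀ x ≤ max K lam := fun x => max_le_max (min_le_right _ _)
    (Set.indicator_le' (fun x _ => le_rfl) (fun x _ => hV.lam_pos.le) x)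
  have sub1 : ∀ x, {b | ∃ y, cubeIndex (r₁ / √3) y = b ∧ dist y x < R} ⊆ cubesMeeting r₁ R x := by
    rintro x b ⟨y, rfl, hd⟩
    exact ⟨y, mem_gridCube_cubeIndex hs y, hd⟩
  have sub2 : ∀ x, {b | NearCells (cubeIndex (r₁ / √3)) R (cubeIndex (r₁ / √3) x) b} ⊆
      cubesMeeting r₁ (3 * R) x := by
    rintro x b ⟨y, z, hy, rfl, hd⟩
    refine ⟨z, mem_gridCube_cubeIndex hs z, ?_⟩
    -- A point of a neighbouring cube within `R` of the cube of `x` has distance less than `R + r₁ <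
    -- 3 R` from `x`.
    have h1 := norm_sub_lt_of_cubeIndex_eq hV.r₁_pos hy
    rw [← dist_eq_norm] at h1
    rw [Metric.mem_ball]
    have h2 := dist_triangle z y x
    rw [dist_comm z y] at h2
    linarith
  refine ⟨_, _, hPV, hMV, {
    measurable_pos := hP₀m.max (hP₀m.comp measurable_neg)
    measurable_neg := hM₀m.max (hM₀m.comp measurable_neg)
    pos_nonneg := fun x => le_max_of_le_left (hP₀0 x)
    neg_nonneg := fun x => le_max_of_le_left (hM₀0 x)
    pos_bdd := ⟨max K lam, fun x => max_le (hP₀K x) (hP₀K (-x))⟩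
    neg_le := fun x => max_le (hM₀Λ x) (hM₀Λ (-x))
    neg_eq_zero := fun x hx => by rw [hM₀R x hx, hM₀R (-x) (by rwa [norm_neg]), max_self]
    pos_even := fun x => by rw [neg_neg, max_comm]
    neg_even := fun x => by rw [neg_neg, max_comm]
    measurable_cell := measurable_cubeIndex _
    le_pos := fun x y hxy => by
      refine le_max_of_le_left (le_max_of_le_right ?_)
      rw [Set.indicator_of_mem]
      exact mem_ball_zero_iff.2 (norm_sub_lt_of_cubeIndex_eq hV.r₁_pos hxy)
    card_pos := cubeCount_pos hV.r₁_pos hR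
    finite_meeting := fun x => (finite_cubesMeeting R hV.r₁_pos x).subset (sub1 x)
    ncard_meeting := fun x => (Set.ncard_le_ncard (sub1 x)
      (finite_cubesMeeting R hV.r₁_pos x)).trans (ncard_cubesMeeting_le R hV.r₁_pos x)
    finite_near := fun x => (finite_cubesMeeting (3 * R) hV.r₁_pos x).subset (sub2 x)
    ncard_near := fun x => (Set.ncard_le_ncard (sub2 x)
      (finite_cubesMeeting (3 * R) hV.r₁_pos x)).trans (ncard_cubesMeeting_le (3 * R) hV.r₁_pos x)
    le_lam := hV.core_gt.le
    energy := fun φ hφ => ?_ }⟩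
  refine (hV.energy hφ).trans (le_of_eq (integral_congr_ae (ae_restrict_of_ae ?_)))
  filter_upwards [hPV, hMV] with x h1 h2
  rw [h1, h2]

end PotentialAssumption

end Potential

/-! ### Transfer to `V` and the choice of localizing sets. -/

section Main

open Filter Topology

/-- The difference of two particle positions is a quasi-measure-preserving function of the
configuration. -/
theorem quasiMeasurePreserving_sub_apply {N : ℕ} {i j : Fin N} (hij : i ≠ j) :
    Measure.QuasiMeasurePreserving (fun x : Config N => x i - x j) volume volume := by
  set L : Config N →ₗ[ℝ] R3 :=
    LinearMap.proj (R := ℝ) (φ := fun _ : Fin N => R3) i - LinearMap.proj j with hL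
  -- Surjectivity is where `i ≠ j` enters: a surjective linear map pulls null sets back to null
  -- sets.
  have hsurj : Function.Surjective L := by
    intro y
    refine ⟨Pi.single i y, ?_⟩
    simp [hL, Pi.single_eq_of_ne (Ne.symm hij)]
  obtain ⟨c, -, hc⟩ := L.exists_map_addHaar_eq_smul_addHaar volume volume hsurj
  refine ⟨(measurable_pi_apply i).sub (measurable_pi_apply j), ?_⟩
  have : (fun x : Config N => x i - x j) = L := rfl
  rw [this, hc]
  exact Measure.smul_absolutelyContinuous

/-- Localized Hamiltonians are monotone in the interaction. -/
theorem LocalizedHamiltonianNonneg.mono {N : ℕ} {S : Fin N → Set (Config N)} {c : ℝ} {U U' : R3 → ℝ}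
    (h : LocalizedHamiltonianNonneg N S c U) (hU : MemLp U ∞ volume) (hU' : MemLp U' ∞ volume)
    (hle : ∀ᵐ x, U x ≤ U' x) : LocalizedHamiltonianNonneg N S c U' := by
  intro Ψ D hΨ
  refine (h Ψ D hΨ).trans (add_le_add_right ?_ _)
  have hint : ∀ {W : R3 → ℝ}, MemLp W ∞ volume → ∀ {i j : Fin N}, i ≠ j →
      Integrable fun x : Config N => 1 / 2 * W (x i - x j) * ‖Ψ x‖ ^ 2 := by
    intro W hW i j hij
    have hq := quasiMeasurePreserving_sub_apply hij
    refine (hΨ.memLp.integrable_norm_pow (by norm_num)).bdd_mul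
      ((hW.1.comp_quasiMeasurePreserving hq).const_mul _)
      (c := 1 / 2 * (eLpNorm W ∞ volume).toReal) ?_
    filter_upwards [hq.ae (enorm_ae_le_eLpNormEssSup W volume)] with x hx
    rw [← eLpNorm_exponent_top] at hx
    have := ENNReal.toReal_mono hW.2.ne hx
    rw [norm_mul]
    refine mul_le_mul (by norm_num) (by simpa using this) (norm_nonneg _) (by norm_num)
  refine Finset.sum_le_sum fun j _ => Finset.sum_le_sum fun i hi => ?_
  have hij := Finset.ne_of_mem_erase hi
  refine integral_mono_ae (hint hU hij).integrableOn (hint hU' hij).integrableOn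
    (ae_restrict_of_ae ?_)
  filter_upwards [(quasiMeasurePreserving_sub_apply hij).ae hle] with x hx
  exact mul_le_mul_of_nonneg_right (mul_le_mul_of_nonneg_left hx (by norm_num)) (by positivity)

/-- Each unordered pair occurs twice in the sum over `i ≠ j`, which the factor `1/2` compensates
because `U` is even. -/
theorem localizedPairForm_univ {N : ℕ} {U : R3 → ℝ} (hU : ∀ x, U (-x) = U x) (Ψ : Config N → ℂ) :
    localizedPairForm (fun _ => Set.univ) U Ψ = pairForm U Ψ := by
  set a : Fin N → Fin N → ℝ := fun i j => ∫ x, U (x i - x j) * ‖Ψ x‖ ^ 2 with ha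
  have hsymm : ∀ i j, a i j = a j i := by
    intro i j
    simp only [ha]
    refine integral_congr_ae (Eventually.of_forall fun x => ?_)
    simp only
    rw [← hU, neg_sub]
  have h1 : localizedPairForm (fun _ => Set.univ) U Ψ =
      ∑ j, ∑ i ∈ Finset.univ.erase j, 1 / 2 * a i j := by
    refine Finset.sum_congr rfl fun j _ => Finset.sum_congr rfl fun i _ => ?_
    rw [Measure.restrict_univ]
    simp only [mul_assoc, ha, integral_const_mul]
  have h2 : ∀ j : Fin N, Finset.univ.erase j = Finset.Iio j ∪ Finset.Ioi j := by
    intro j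
    ext i
    simp
  have h3 : ∀ j : Fin N, Disjoint (Finset.Iio j) (Finset.Ioi j) := fun j =>
    Finset.disjoint_left.2 fun i hi hi' => lt_asymm (Finset.mem_Iio.1 hi) (Finset.mem_Ioi.1 hi')
  have h4 : ∑ j, ∑ i ∈ Finset.Iio j, 1 / 2 * a i j = ∑ i, ∑ j ∈ Finset.Ioi i, 1 / 2 * a i j :=
    Finset.sum_comm' fun j i => by simp
  have h5 : ∑ j, ∑ i ∈ Finset.Ioi j, 1 / 2 * a i j = ∑ i, ∑ j ∈ Finset.Ioi i, 1 / 2 * a i j :=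
    Finset.sum_congr rfl fun j _ => Finset.sum_congr rfl fun i _ => by rw [hsymm]
  rw [h1]
  simp only [h2, Finset.sum_union (h3 _), Finset.sum_add_distrib]
  rw [h4, h5, ← Finset.sum_add_distrib, pairForm]
  refine Finset.sum_congr rfl fun i _ => ?_
  rw [← Finset.sum_add_distrib]
  exact Finset.sum_congr rfl fun j _ => by ring

theorem kineticForm_nonneg {N : ℕ} (S : Fin N → Set (Config N))
    (D : Fin N → Fin 3 → Config N → ℂ) : 0 ≤ kineticForm S D :=
  Finset.sum_nonneg fun _ _ => integral_nonneg fun _ => Finset.sum_nonneg fun _ _ => by positivity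

/-- The unused part `1 - c` of the kinetic energy is nonnegative and may be added. -/
theorem LocalizedHamiltonianNonneg.hamiltonianNonneg {N : ℕ} {c : ℝ} {U : R3 → ℝ}
    (h : LocalizedHamiltonianNonneg N (fun _ => Set.univ) c U) (hc : c ≤ 1)
    (hU : ∀ x, U (-x) = U x) : HamiltonianNonneg N U := by
  intro Ψ D hΨ
  have h1 := h Ψ D hΨ
  rw [localizedPairForm_univ hU] at h1
  nlinarith [kineticForm_nonneg (fun _ => Set.univ) D]

theorem isOpen_otherPairClose (N : ℕ) (l : Fin N) : IsOpen (otherPairClose N l) := by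
  simp only [otherPairClose, Set.ofPred_exists, Set.ofPred_and]
  refine isOpen_iUnion fun j => isOpen_iUnion fun k => ?_
  refine isOpen_const.inter (isOpen_const.inter (isOpen_const.inter ?_))
  exact isOpen_lt (by fun_prop) continuous_const

theorem otherPairClose_congr {N : ℕ} {l : Fin N} {x y : Config N} (h : ∀ k, k ≠ l → x k = y k) :
    x ∈ otherPairClose N l ↔ y ∈ otherPairClose N l := by
  refine exists_congr fun j => exists_congr fun k => and_congr_right fun _ =>
    and_congr_right fun hj => and_congr_right fun hk => ?_
  rw [h j hj, h k hk]

/-- A configuration lies in none of the sets `otherPairClose N l`, or in all but two. -/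
theorem otherPairClose_compl {N : ℕ} (x : Config N) :
    (∀ l, x ∉ otherPairClose N l) ∨ ∃ p q, ∀ l, x ∉ otherPairClose N l → l = p ∨ l = q := by
  by_cases h : ∃ l, x ∈ otherPairClose N l
  · obtain ⟨l, j, k, hjk, -, -, hd⟩ := h
    -- A close pair `j, k` is a pair of others for every particle except `j` and `k` themselves.
    refine Or.inr ⟨j, k, fun m hm => ?_⟩
    by_contra! hne
    exact hm ⟨j, k, hjk, hne.1.symm, hne.2.symm, hd⟩
  · exact Or.inl (not_exists.1 h)

theorem MemLp.scale {U : R3 → ℝ} (hU : MemLp U ∞ volume) {s : ℝ} (hs : s ≠ 0) :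
    MemLp (fun x => s ^ 2 * U (s • x)) ∞ volume := by
  have hq : Measure.QuasiMeasurePreserving (fun x : R3 => s • x) volume volume := by
    refine ⟨measurable_const_smul s, ?_⟩
    rw [Measure.map_addHaar_smul volume hs]
    exact Measure.smul_absolutelyContinuous
  refine MemLp.const_mul (f := fun x => U (s • x)) ?_ (s ^ 2)
  refine memLp_top_of_bound (hU.1.comp_quasiMeasurePreserving hq) (eLpNorm U ∞ volume).toReal ?_
  filter_upwards [hq.ae (enorm_ae_le_eLpNormEssSup U volume)] with x hx
  rw [← eLpNorm_exponent_top] at hx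
  simpa using ENNReal.toReal_mono hU.2.ne hx

variable {V : R3 → ℝ} {r₁ r₂ R lam : ℝ}

theorem PotentialAssumption.memLp_pos (hV : PotentialAssumption V r₁ r₂ R lam) :
    MemLp (fun x => (V x)⁺) ∞ volume := by
  refine (hV.memLp_top.add hV.memLp_neg).ae_eq (Eventually.of_forall fun x => ?_)
  simp only [Pi.add_apply]
  linarith [posPart_sub_negPart (V x)]

/-- The localized Hamiltonian with a scaled interaction whose attractive part is enlarged. -/
theorem PotentialAssumption.localizedHamiltonianNonneg (hV : PotentialAssumption V r₁ r₂ R lam)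
    {s : ℝ} (hs : 0 < s) {N : ℕ} {S : Fin N → Set (Config N)} (hS : ∀ j, MeasurableSet (S j))
    (hSj : ∀ j, ∀ x y : Config N, (∀ k, k ≠ j → x k = y k) → (x ∈ S j ↔ y ∈ S j))
    (hS2 : ∀ x, (∀ j, x ∉ S j) ∨ ∃ p q, ∀ j, x ∉ S j → j = p ∨ j = q) :
    LocalizedHamiltonianNonneg N S (7 / 8)
      (fun x => s ^ 2 * (V (s • x))⁺ - 9 / 8 * (s ^ 2 * (V (s • x))⁻)) := by
  obtain ⟨P, M, hP, hM, h⟩ := hV.exists_isCellPotential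
  have hq : Measure.QuasiMeasurePreserving (fun x : R3 => s • x) volume volume := by
    refine ⟨measurable_const_smul s, ?_⟩
    rw [Measure.map_addHaar_smul volume hs.ne']
    exact Measure.smul_absolutelyContinuous
  have hae : ∀ᵐ x, s ^ 2 * P (s • x) - 9 / 8 * (s ^ 2 * M (s • x)) =
      s ^ 2 * (V (s • x))⁺ - 9 / 8 * (s ^ 2 * (V (s • x))⁻) := by
    filter_upwards [hq.ae hP, hq.ae hM] with x h1 h2
    rw [h1, h2]
  have hmem : MemLp (fun x => s ^ 2 * (V (s • x))⁺ - 9 / 8 * (s ^ 2 * (V (s • x))⁻)) ∞ volume :=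
    (MemLp.scale hV.memLp_pos hs.ne').sub ((MemLp.scale hV.memLp_neg hs.ne').const_mul (9 / 8))
  refine ((h.scale hs).localizedHamiltonianNonneg hS hSj hS2).mono
    (hmem.ae_eq (hae.mono fun _ hx => hx.symm)) hmem (hae.mono fun _ hx => hx.le)

theorem hamiltonianNonneg_zero (U : R3 → ℝ) : HamiltonianNonneg 0 U := fun Ψ D _ => by
  simp [kineticForm, pairForm]

theorem localizedHamiltonianNonneg_zero (S : Fin 0 → Set (Config 0)) (c : ℝ) (U : R3 → ℝ) :
    LocalizedHamiltonianNonneg 0 S c U := fun Ψ D _ => by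
  simp [kineticForm, localizedPairForm]

end Main

end

theorem mainTheorem2 (V : R3 → ℝ) (r₁ r₂ R lam : ℝ) (hV : PotentialAssumption V r₁ r₂ R lam) :
    (∀ N : ℕ, HamiltonianNonneg N V) ∧
    ∃ ε : ℝ, 0 < ε ∧ ε < 1 ∧ ∀ N : ℕ,
      HamiltonianNonneg N
        (fun x => scaled N (fun y => (V y)⁺) x - (1 + ε) * scaled N (fun y => (V y)⁻) x) ∧
      LocalizedHamiltonianNonneg N (otherPairClose N) (1 - ε) (scaled N V) := by
  have heven : ∀ x, V (-x) = V x := fun x => hV.radial _ _ (norm_neg x)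
  have hle : ∀ (s : ℝ) (x : R3), s ^ 2 * (V (s • x))⁺ - 9 / 8 * (s ^ 2 * (V (s • x))⁻) ≤
      s ^ 2 * V (s • x) := by
    intro s x
    have h1 := posPart_sub_negPart (V (s • x))
    have h2 : 0 ≤ s ^ 2 * (V (s • x))⁻ := mul_nonneg (sq_nonneg s) (negPart_nonneg _)
    have h3 : s ^ 2 * V (s • x) = s ^ 2 * (V (s • x))⁺ - s ^ 2 * (V (s • x))⁻ := by
      rw [← mul_sub, h1]
    linarith
  have hmem : ∀ {s : ℝ}, 0 < s →
      MemLp (fun x => s ^ 2 * (V (s • x))⁺ - 9 / 8 * (s ^ 2 * (V (s • x))⁻)) ∞ volume := fun hs =>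
    (MemLp.scale hV.memLp_pos hs.ne').sub ((MemLp.scale hV.memLp_neg hs.ne').const_mul (9 / 8))
  have huniv : ∀ {s : ℝ}, 0 < s → ∀ N : ℕ, LocalizedHamiltonianNonneg N (fun _ => Set.univ) (7 / 8)
      (fun x => s ^ 2 * (V (s • x))⁺ - 9 / 8 * (s ^ 2 * (V (s • x))⁻)) := by
    intro s hs N
    refine hV.localizedHamiltonianNonneg hs (fun _ => MeasurableSet.univ) (fun _ _ _ _ => Iff.rfl)
      fun x => ?_
    by_cases h : Nonempty (Fin N)
    · obtain ⟨p⟩ := h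
      -- With the whole space no particle is left out, so any witness serves.
      exact Or.inr ⟨p, p, fun j hj => absurd (Set.mem_univ x) hj⟩
    · exact Or.inl fun j => absurd ⟨j⟩ h
  refine ⟨fun N => ?_, 1 / 8, by norm_num, by norm_num, fun N => ?_⟩
  · refine ((huniv one_pos N).mono (hmem one_pos) hV.memLp_top
      (Filter.Eventually.of_forall fun x => ?_)).hamiltonianNonneg (by norm_num) heven
    simpa using hle 1 x
  -- For `N = 0` the scaling degenerates, but all the sums are empty.
  · rcases Nat.eq_zero_or_pos N with rfl | hN
    · exact ⟨hamiltonianNonneg_zero _, localizedHamiltonianNonneg_zero _ _ _⟩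
    have hs : (0 : ℝ) < N := by exact_mod_cast hN
    have e1 : (1 : ℝ) + 1 / 8 = 9 / 8 := by norm_num
    have e2 : (1 : ℝ) - 1 / 8 = 7 / 8 := by norm_num
    rw [e1, e2]
    refine ⟨(huniv hs N).hamiltonianNonneg (by norm_num) fun x => by simp only [smul_neg, heven], ?_⟩
    exact (hV.localizedHamiltonianNonneg hs (fun l => (isOpen_otherPairClose N l).measurableSet)
      (fun l x y h => otherPairClose_congr h) otherPairClose_compl).mono (hmem hs)
      (MemLp.scale hV.memLp_top hs.ne') (Filter.Eventually.of_forall (hle N))
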